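/- Let $p\ge 1$ be an integer and let $M_p=S^3\setminus K$ be the complement of the $(2,2p+1)$-torus knot $K$, where $K$ is drawn as the closure of the two-strand braid with $2p+1$ negative crossings. Let $R$ be a commutative ring and $t\in R$ a unit (for example $R=\mathbb C[t,t^{-1}]$, or $R=\mathbb C$ and $t\neq 0$). The Kauffman bracket skein module $K_t(M_p)$ is the quotient of the free $R$-module with basis the isotopy classes of framed (unoriented) links in $M_p$, including the empty link, by the submodule generated by all $L_\times-t\,L_A-t^{-1}L_B$ and all $L\sqcup\bigcirc+(t^2+t^{-2})L$. Here $L_\times,L_A,L_B$ are identical except in a ball, in which $L_\times$ is a crossing, $L_A$ is its smoothing that joins the two regions swept out when the upper strand is turned counterclockwise, and $L_B$ is the other smoothing; $\bigcirc$ is a trivial circle that bounds a disk disjoint from $L$; framings are parallel to the plane of the drawing. Let $x$ be a meridian of $K$, encircling one strand of the braid, and let $y$ be the curve that encircles both strands of the braid, both with the framing parallel to the plane. Let $x^ky^n\in K_t(M_p)$ be the class of the link of $k$ parallel copies of $x$ and $n$ parallel copies of $y$, and for polynomials $f=\sum_k a_kX^k$ and $g=\sum_n b_nX^n$ in $R[X]$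 put $f(x)g(y)=\sum_{k,n}a_kb_n\,x^ky^n$. Let $S_n$, $n\in\mathbb Z$, be the polynomials with $S_0=1$, $S_1=X$ and $S_{n+1}=XS_n-S_{n-1}$. **Theorem 3.1.** For $i=0,1,\ldots,p+1$ one has in $K_t(M_p)$ $$t^{-2i-1}S_{p+i}(y)+t^{2i+1}S_{p-i-1}(y)=(-1)^iS_{2i}(x)\bigl(tS_{p-1}(y)+t^{-1}S_p(y)\bigr).$$ -/

import Mathlib

namespace TorusSkein

/-! Links in the complement of a knot `K` in the 3-sphere are represented, as usual, by planar
diagrams of `K ∪ L` with the blackboard framing, where the diagram of `K` is fixed once and for all.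
Diagrams are in general position with respect to the height function of the plane and are read
from the bottom to the top as a sequence of elementary slices. Each strand carries a colour, which
says whether it belongs to `K` or to `L`. -/

/-- The colour of a strand: it is part of the removed knot `K`, or of the framed link `L` in the
complement of `K`. -/
inductive Colour : Type
  | knot : Colour
  | link : Colour
  deriving DecidableEq

/-- Is the strand a strand of the removed knot? -/
def Colour.isKnot : Colour → Bool
  | .knot => true
  | .link => false

/-- The singular part of an elementary slice: a local minimum `cup`, a local maximum `cap`, or
a crossing, in which the strand coloured `a` runs from the bottom left to the top right and the
strand coloured `b` from the bottom right to the top left. In `cross true a b` the strand coloured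
`a` is the upper one (so the crossing is positive if both strands are directed upwards), and in
`cross false a b` the strand coloured `b` is the upper one. -/
inductive Gen : Type
  | cup (c : Colour) : Gen
  | cap (c : Colour) : Gen
  | cross (e : Bool) (a b : Colour) : Gen

/-- Colours of the strands entering at the bottom, from left to right. -/
def Gen.src : Gen → List Colour
  | .cup _ => []
  | .cap c => [c, c]
  | .cross _ a b => [a, b]

/-- Colours of the strands leaving at the top, from left to right. -/
def Gen.tgt : Gen → List Colour
  | .cup c => [c, c]
  | .cap _ => []
  | .cross _ a b => [b, a]

/-- An elementary slice: one generator, with vertical strands to its left and to its right. -/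
structure Slice : Type where
  left : List Colour
  gen : Gen
  right : List Colour

/-- The strands at the bottom of a slice. -/
def Slice.src (s : Slice) : List Colour := s.left ++ s.gen.src ++ s.right

/-- The strands at the top of a slice. -/
def Slice.tgt (s : Slice) : List Colour := s.left ++ s.gen.tgt ++ s.right

/-- The slices of the word `w`, stacked from the bottom to the top, fit together to a tangle diagram
with the strands `a` at the bottom and `b` at the top. -/
def IsTangle : List Colour → List Slice → List Colour → Prop
  | a, [], b => a = b
  | a, s :: w, b => s.src = a ∧ IsTangle s.tgt w b

/-- What remains of a slice when the strands of the link are erased (`none` if the generator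
itself disappears or becomes trivial). -/
def Slice.knotPart : Slice → Option Slice
  | ⟨l, .cup .knot, r⟩ => some ⟨l.filter Colour.isKnot, .cup .knot, r.filter Colour.isKnot⟩
  | ⟨l, .cap .knot, r⟩ => some ⟨l.filter Colour.isKnot, .cap .knot, r.filter Colour.isKnot⟩
  | ⟨l, .cross e .knot .knot, r⟩ =>
      some ⟨l.filter Colour.isKnot, .cross e .knot .knot, r.filter Colour.isKnot⟩
  | _ => none

/-- The bottom of the diagram of the torus knot: two nested minima. -/
def knotBottom : List Slice :=
  [⟨[], .cup .knot, []⟩, ⟨[.knot], .cup .knot, [.knot]⟩]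

/-- The two-strand braid with `2p+1` negative crossings, formed by the two leftmost strands; the
two strands on the right are the closing strands. -/
def knotTwists (p : ℕ) : List Slice :=
  List.replicate (2 * p + 1) ⟨[], .cross false .knot .knot, [.knot, .knot]⟩

/-- The top of the diagram of the torus knot: two nested maxima. -/
def knotTop : List Slice :=
  [⟨[.knot], .cap .knot, [.knot]⟩, ⟨[], .cap .knot, []⟩]

/-- The diagram of the `(2,2p+1)`-torus knot, as the closure of a two-strand braid with
`2p+1` crossings. -/
def torusWord (p : ℕ) : List Slice := knotBottom ++ knotTwists p ++ knotTop

/-- A diagram of a framed link in the complement of the `(2,2p+1)`-torus knot: a closed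
diagram whose knot part is precisely the fixed diagram of the torus knot. The link has the
blackboard framing; it may be empty. -/
structure Diagram (p : ℕ) : Type where
  word : List Slice
  closed : IsTangle [] word []
  knotPart : word.filterMap Slice.knotPart = torusWord p

/-- The elementary moves of framed tangle diagrams: planar isotopy (`exchange`, `zig`, `zag`), the
second and third Reidemeister moves, the passage of a strand above or below an extremum
(`slideCap`, `slideCup`), and the framed first Reidemeister move (`curl`: two curls with
the same writhe are interchangeable). -/
inductive LocalMove : List Slice → List Slice → Prop
  /-- Two generators that are side by side may be performed in either order. -/
  | exchange (l m r : List Colour) (g h : Gen) :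
      LocalMove [⟨l, g, m ++ h.src ++ r⟩, ⟨l ++ g.tgt ++ m, h, r⟩]
        [⟨l ++ g.src ++ m, h, r⟩, ⟨l, g, m ++ h.tgt ++ r⟩]
  | zig (l r : List Colour) (c : Colour) :
      LocalMove [⟨l, .cup c, [c] ++ r⟩, ⟨l ++ [c], .cap c, r⟩] []
  | zag (l r : List Colour) (c : Colour) :
      LocalMove [⟨l ++ [c], .cup c, r⟩, ⟨l, .cap c, [c] ++ r⟩] []
  | curl (l r : List Colour) (c : Colour) (e : Bool) :
      LocalMove
        [⟨l ++ [c], .cup c, r⟩, ⟨l, .cross e c c, [c] ++ r⟩, ⟨l ++ [c], .cap c, r⟩]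
        [⟨l, .cup c, [c] ++ r⟩, ⟨l ++ [c], .cross e c c, r⟩, ⟨l, .cap c, [c] ++ r⟩]
  | reidemeister2 (l r : List Colour) (a b : Colour) (e : Bool) :
      LocalMove [⟨l, .cross e a b, r⟩, ⟨l, .cross (!e) b a, r⟩] []
  /-- The condition says that the three strands `a`, `b`, `c` lie at three different levels. -/
  | reidemeister3 (l r : List Colour) (a b c : Colour) (ab ac bc : Bool)
      (levels : ab = bc → ac = ab) :
      LocalMove
        [⟨l, .cross ab a b, [c] ++ r⟩, ⟨l ++ [b], .cross ac a c, r⟩, ⟨l, .cross bc b c, [a] ++ r⟩]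
        [⟨l ++ [a], .cross bc b c, r⟩, ⟨l, .cross ac a c, [b] ++ r⟩, ⟨l ++ [c], .cross ab a b, r⟩]
  | slideCap (l r : List Colour) (a c : Colour) (e : Bool) :
      LocalMove
        [⟨l, .cross e a c, [c] ++ r⟩, ⟨l ++ [c], .cross e a c, r⟩, ⟨l, .cap c, [a] ++ r⟩]
        [⟨l ++ [a], .cap c, r⟩]
  | slideCup (l r : List Colour) (a c : Colour) (e : Bool) :
      LocalMove
        [⟨l ++ [a], .cup c, r⟩, ⟨l, .cross e a c, [c] ++ r⟩, ⟨l ++ [c], .cross e a c, r⟩]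
        [⟨l, .cup c, [a] ++ r⟩]

/-- Two diagrams differ by one elementary move. Since both are diagrams over the same fixed diagram
of the torus knot, the knot stays fixed and the link moves in its complement. -/
def Diagram.Step {p : ℕ} (d d' : Diagram p) : Prop :=
  ∃ u m m' v : List Slice, LocalMove m m' ∧ d.word = u ++ m ++ v ∧ d'.word = u ++ m' ++ v

/-- The isotopy classes of framed links in the complement of the `(2,2p+1)`-torus knot: diagrams
up to the equivalence relation generated by the elementary moves. -/
def LinkClass (p : ℕ) : Type := Quotient (Relation.EqvGen.setoid (Diagram.Step (p := p)))

/-- The isotopy class of the framed link with a given diagram. -/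
def Diagram.isotopyClass {p : ℕ} (d : Diagram p) : LinkClass p := Quotient.mk _ d

noncomputable section

variable {R : Type*} [CommRing R]

/-- The link with diagram `d`, as a basis element of the free module on the isotopy classes. -/
def Diagram.basisElt (R : Type*) [CommRing R] {p : ℕ} (d : Diagram p) : LinkClass p →₀ R :=
  Finsupp.single d.isotopyClass 1

/-- The expressions that are set to zero in the Kauffman bracket skein module. In the first two, `d`
has a crossing of two link strands, which is replaced by two vertical arcs in `dv` and by two
horizontal arcs in `dh`; as always, the smoothing with coefficient `t` joins the two regions that
are swept out when the upper strand is turned counterclockwise. In the third, `d` is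
`d'` with a trivial circle added. -/
inductive SkeinRelator (t : Rˣ) (p : ℕ) : (LinkClass p →₀ R) → Prop
  | crossTrue (d dv dh : Diagram p) (u v : List Slice) (l r : List Colour)
      (hd : d.word = u ++ [⟨l, .cross true .link .link, r⟩] ++ v)
      (hv : dv.word = u ++ v)
      (hh : dh.word = u ++ [⟨l, .cap .link, r⟩, ⟨l, .cup .link, r⟩] ++ v) :
      SkeinRelator t p (d.basisElt R - (t : R) • dv.basisElt R - ((t⁻¹ : Rˣ) : R) • dh.basisElt R)
  | crossFalse (d dv dh : Diagram p) (u v : List Slice) (l r : List Colour)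
      (hd : d.word = u ++ [⟨l, .cross false .link .link, r⟩] ++ v)
      (hv : dv.word = u ++ v)
      (hh : dh.word = u ++ [⟨l, .cap .link, r⟩, ⟨l, .cup .link, r⟩] ++ v) :
      SkeinRelator t p (d.basisElt R - (t : R) • dh.basisElt R - ((t⁻¹ : Rˣ) : R) • dv.basisElt R)
  | circle (d d' : Diagram p) (u v : List Slice) (l r : List Colour)
      (hd : d.word = u ++ [⟨l, .cup .link, r⟩, ⟨l, .cap .link, r⟩] ++ v)
      (hd' : d'.word = u ++ v) :
      SkeinRelator t p
        (d.basisElt R + ((t ^ 2 : Rˣ) : R) • d'.basisElt R + ((t ^ (-2 : ℤ) : Rˣ) : R) • d'.basisElt R)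

/-- The Kauffman bracket skein module, with parameter `t`, of the complement of
the `(2,2p+1)`-torus knot. -/
abbrev SkeinModule (t : Rˣ) (p : ℕ) : Type _ :=
  (LinkClass p →₀ R) ⧸ Submodule.span R {z | SkeinRelator t p z}

/-- The class of a framed link in the skein module. -/
def Diagram.skein (t : Rˣ) {p : ℕ} (d : Diagram p) : SkeinModule t p :=
  Submodule.Quotient.mk (d.basisElt R)

end

/-- The curve `x`: a meridian of the knot, which runs around the leftmost strand of the braid, in
front of it and then back behind it. -/
def meridian : List Slice :=
  [⟨[], .cup .link, [.knot, .knot, .knot, .knot]⟩,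
   ⟨[.link], .cross true .link .knot, [.knot, .knot, .knot]⟩,
   ⟨[.link], .cross true .knot .link, [.knot, .knot, .knot]⟩,
   ⟨[], .cap .link, [.knot, .knot, .knot, .knot]⟩]

/-- The curve `y`, which runs around both strands of the braid, in front of them and then back behind
them. -/
def axis : List Slice :=
  [⟨[], .cup .link, [.knot, .knot, .knot, .knot]⟩,
   ⟨[.link], .cross true .link .knot, [.knot, .knot, .knot]⟩,
   ⟨[.link, .knot], .cross true .link .knot, [.knot, .knot]⟩,
   ⟨[.link, .knot], .cross true .knot .link, [.knot, .knot]⟩,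
   ⟨[.link], .cross true .knot .link, [.knot, .knot, .knot]⟩,
   ⟨[], .cap .link, [.knot, .knot, .knot, .knot]⟩]

/-- `k` parallel copies of the curve `x` and `n` parallel copies of the curve `y`, stacked along the
strands of the torus knot. -/
def xyWord (p k n : ℕ) : List Slice :=
  knotBottom ++ (List.replicate k meridian).flatten ++ (List.replicate n axis).flatten ++
    knotTwists p ++ knotTop

theorem isTangle_append {w w' : List Slice} {a b c : List Colour}
    (h : IsTangle a w b) (h' : IsTangle b w' c) : IsTangle a (w ++ w') c := by
  induction w generalizing a with
  | nil => cases h; exact h'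
  | cons s w ih => exact ⟨h.1, ih h.2⟩

theorem isTangle_replicate {w : List Slice} {a : List Colour} (h : IsTangle a w a) (n : ℕ) :
    IsTangle a (List.replicate n w).flatten a := by
  induction n with
  | zero => exact rfl
  | succ n ih =>
    rw [List.replicate_succ, List.flatten_cons]
    exact isTangle_append h ih

theorem isTangle_knotTwists (p : ℕ) :
    IsTangle [.knot, .knot, .knot, .knot] (knotTwists p) [.knot, .knot, .knot, .knot] := by
  have h := isTangle_replicate (w := [⟨[], .cross false .knot .knot, [.knot, .knot]⟩])
    (a := [.knot, .knot, .knot, .knot]) ⟨rfl, rfl⟩ (2 * p + 1)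
  simpa [knotTwists] using h

theorem isTangle_xyWord (p k n : ℕ) : IsTangle [] (xyWord p k n) [] := by
  refine isTangle_append (b := [.knot, .knot, .knot, .knot]) (isTangle_append
    (b := [.knot, .knot, .knot, .knot]) (isTangle_append (b := [.knot, .knot, .knot, .knot])
    (isTangle_append (b := [.knot, .knot, .knot, .knot]) ?_ (isTangle_replicate ?_ k))
    (isTangle_replicate ?_ n)) (isTangle_knotTwists p)) ?_
  · exact ⟨rfl, rfl, rfl⟩
  · exact ⟨rfl, rfl, rfl, rfl, rfl⟩
  · exact ⟨rfl, rfl, rfl, rfl, rfl, rfl, rfl⟩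
  · exact ⟨rfl, rfl, rfl⟩

theorem knotPart_replicate {w : List Slice} (h : w.filterMap Slice.knotPart = []) (n : ℕ) :
    (List.replicate n w).flatten.filterMap Slice.knotPart = [] := by
  induction n with
  | zero => rfl
  | succ n ih => rw [List.replicate_succ, List.flatten_cons, List.filterMap_append, h, ih]; rfl

theorem knotPart_xyWord (p k n : ℕ) :
    (xyWord p k n).filterMap Slice.knotPart = torusWord p := by
  have hx : (List.replicate k meridian).flatten.filterMap Slice.knotPart = [] :=
    knotPart_replicate rfl k
  have hy : (List.replicate n axis).flatten.filterMap Slice.knotPart = [] :=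
    knotPart_replicate rfl n
  have hb : knotBottom.filterMap Slice.knotPart = knotBottom := rfl
  have ht : knotTop.filterMap Slice.knotPart = knotTop := rfl
  have hs : (knotTwists p).filterMap Slice.knotPart = knotTwists p := by
    unfold knotTwists
    induction 2 * p + 1 with
    | zero => rfl
    | succ n ih =>
      rw [List.replicate_succ, List.filterMap_cons_some (by rfl), ih]
      rfl
  simp only [xyWord, torusWord, List.filterMap_append, hx, hy, hb, ht, hs, List.append_nil]

/-- The link `x^k y^n`. -/
def xyDiagram (p k n : ℕ) : Diagram p :=
  ⟨xyWord p k n, isTangle_xyWord p k n, knotPart_xyWord p k n⟩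

/-- The skein `f(x) g(y)` for polynomials `f = ∑ aₖ xᵏ` and `g = ∑ bₙ yⁿ`: the linear combination
`∑ aₖ bₙ xᵏyⁿ`. -/
noncomputable def polySkein {R : Type*} [CommRing R] (t : Rˣ) (p : ℕ) (f g : Polynomial R) :
    SkeinModule t p :=
  f.sum fun k a => g.sum fun n b => (a * b) • (xyDiagram p k n).skein t

end TorusSkein

/-!
The proof compares two descriptions of one curve, without computing the skein module.

Words of slices act on the functions that complete them to closed diagrams; this gives an algebra
`SliceAlg` in which elementary moves and Kauffman relations become equations between products of
slices, valid in every context. For `j + k + l = 2p + 1` consider the unknotted curve `hookArc j k`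
that leaves the plane through the gap between the two strands of the braid, passes behind `k`
consecutive crossings, and comes back through the gap, with `j` crossings below it and `l` above it.

* A curve around both strands of the braid can be merged with such a curve. This gives a three-term
  recurrence in `k` with an inhomogeneous term consisting of two meridians (`axisAt_mul_hookArc`).
  The cases `k = 0` and `k = 1` are a trivial circle and a combination of `x²` and `y`
  (`hookArc_zero`, `hookArc_one`). Since the closure of the braid is a knot, every meridian can be
  moved next to the copies of `x` at the lower end (`closing_two_mer`). So the curve represents
  `P_k(x², y)` for an explicit polynomial, `arcPoly` (`closing_hookArc`).
* The ends of the curve can be pushed around the closing strand of the knot (`hook_slide`). As the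
  curve does not change if both of its hooks are turned over (`hookArc_swap`), the curve around `k`
  crossings is also the curve around the other `2p + 1 - k` crossings. Hence `P_k = P_{2p+1-k}` in
  the skein module, and this remains true after multiplication by powers of `x`.

The rest is algebra. The differences `P_{k+1} - P_k` satisfy a homogeneous recurrence and are
combinations of Chebyshev polynomials (`arcPoly_succ_sub`). Sums of two differences in positions
symmetric to the middle are relations; up to a unit they say that the left-hand sides `f_i` of the
theorem satisfy `f_{i+1} = (2 - x²) f_i - f_{i-1}` with `f_{-1} = f_0`. This is also the recurrence of
`(-1)^i S_{2i}(x)`, so `f_i = (-1)^i S_{2i}(x) f_0` (`pairedS_sub_mem`).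
-/

namespace TorusSkein

/-! ### The algebra of slices -/

theorem IsTangle.tgt_unique {w : List Slice} {a b b' : List Colour}
    (h : IsTangle a w b) (h' : IsTangle a w b') : b = b' := by
  induction w generalizing a with
  | nil => exact h.symm.trans h'
  | cons s w ih => exact ih h.2 h'.2

theorem IsTangle.src_unique {w : List Slice} {a a' b : List Colour}
    (h : IsTangle a w b) (h' : IsTangle a' w b) : a = a' := by
  cases w with
  | nil => exact Eq.trans h h'.symm
  | cons s w => exact h.1.symm.trans h'.1

theorem isTangle_append_iff {w w' : List Slice} {a c : List Colour} :
    IsTangle a (w ++ w') c ↔ ∃ b, IsTangle a w b ∧ IsTangle b w' c := by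
  constructor
  · intro h
    induction w generalizing a with
    | nil => exact ⟨a, rfl, h⟩
    | cons s w ih =>
      obtain ⟨b, hb, hb'⟩ := ih h.2
      exact ⟨b, ⟨h.1, hb⟩, hb'⟩
  · rintro ⟨b, h, h'⟩
    exact isTangle_append h h'

section
variable {R : Type*} [CommRing R] (t : Rˣ) (p : ℕ)

open Classical in
/-- The class of the link with diagram `w` in the skein module; it is zero if `w` is not the word
of a diagram over the fixed diagram of the torus knot. -/
noncomputable def wordSkein (w : List Slice) : SkeinModule t p :=
  if h : IsTangle [] w [] ∧ w.filterMap Slice.knotPart = torusWord p then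
    Diagram.skein t ⟨w, h.1, h.2⟩ else 0

theorem Diagram.wordSkein_word (d : Diagram p) : wordSkein t p d.word = d.skein t := by
  unfold wordSkein
  rw [dif_pos ⟨d.closed, d.knotPart⟩]

theorem wordSkein_eq_zero {w : List Slice} (h : ¬ IsTangle [] w []) : wordSkein t p w = 0 := by
  unfold wordSkein
  rw [dif_neg fun h' => h h'.1]

theorem wordSkein_eq_zero' {w : List Slice} (h : ¬ w.filterMap Slice.knotPart = torusWord p) :
    wordSkein t p w = 0 := by
  unfold wordSkein
  rw [dif_neg fun h' => h h'.2]

/-- Elementary moves preserve the skein also for words that are not diagrams; their skein is zero on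
both sides. -/
theorem wordSkein_move {u m m' v : List Slice} {a b : List Colour} (hu : IsTangle [] u a)
    (hm : IsTangle a m b) (hm' : IsTangle a m' b) (h : LocalMove m m')
    (hk : m.filterMap Slice.knotPart = m'.filterMap Slice.knotPart) :
    wordSkein t p (u ++ m ++ v) = wordSkein t p (u ++ m' ++ v) := by
  by_cases hc : IsTangle b v []
  · by_cases hw : (u ++ m ++ v).filterMap Slice.knotPart = torusWord p
    · have hw' : (u ++ m' ++ v).filterMap Slice.knotPart = torusWord p := by
        rw [← hw]
        simp only [List.filterMap_append, hk]
      have h1 := isTangle_append (isTangle_append hu hm) hc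
      have h2 := isTangle_append (isTangle_append hu hm') hc
      have e1 := Diagram.wordSkein_word t p ⟨_, h1, hw⟩
      have e2 := Diagram.wordSkein_word t p ⟨_, h2, hw'⟩
      rw [e1, e2]
      have : Diagram.isotopyClass (⟨_, h1, hw⟩ : Diagram p) =
          Diagram.isotopyClass (⟨_, h2, hw'⟩ : Diagram p) :=
        Quotient.sound (Relation.EqvGen.rel _ _ ⟨u, m, m', v, h, rfl, rfl⟩)
      unfold Diagram.skein Diagram.basisElt
      rw [this]
    · rw [wordSkein_eq_zero' t p hw, wordSkein_eq_zero' t p]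
      rwa [List.filterMap_append, List.filterMap_append, ← hk, ← List.filterMap_append,
        ← List.filterMap_append]
  · have key : ∀ x, IsTangle a x b → wordSkein t p (u ++ x ++ v) = 0 := by
      intro x hx
      apply wordSkein_eq_zero
      intro h
      obtain ⟨c, h1, h2⟩ := isTangle_append_iff.1 h
      rw [(isTangle_append hu hx).tgt_unique h1] at hc
      exact hc h2
    rw [key m hm, key m' hm']

theorem mk_eq_zero_of_relator {z : LinkClass p →₀ R} (h : SkeinRelator t p z) :
    (Submodule.Quotient.mk z : SkeinModule t p) = 0 :=
  (Submodule.Quotient.mk_eq_zero _).2 (Submodule.subset_span h)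

/-- A linear relation between the skeins of diagrams that differ in a part which does not meet the
knot also holds for words that need not be diagrams: if one of the three words fails to be a
diagram, so do the others, and all terms are zero. -/
theorem wordSkein_linear {u m m₁ m₂ v : List Slice} {a b : List Colour} (hu : IsTangle [] u a)
    (hm : IsTangle a m b) (hm₁ : IsTangle a m₁ b) (hm₂ : IsTangle a m₂ b)
    (hk : m.filterMap Slice.knotPart = []) (hk₁ : m₁.filterMap Slice.knotPart = [])
    (hk₂ : m₂.filterMap Slice.knotPart = []) (c₁ c₂ : R)
    (h : ∀ d d₁ d₂ : Diagram p, d.word = u ++ m ++ v → d₁.word = u ++ m₁ ++ v →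
      d₂.word = u ++ m₂ ++ v → d.skein t = c₁ • d₁.skein t + c₂ • d₂.skein t) :
    wordSkein t p (u ++ m ++ v) =
      c₁ • wordSkein t p (u ++ m₁ ++ v) + c₂ • wordSkein t p (u ++ m₂ ++ v) := by
  by_cases hc : IsTangle b v []
  · by_cases hw : (u ++ v).filterMap Slice.knotPart = torusWord p
    · have key : ∀ x, x.filterMap Slice.knotPart = [] →
          (u ++ x ++ v).filterMap Slice.knotPart = torusWord p := by
        intro x hx
        simpa [List.filterMap_append, hx] using hw
      have h0 := h ⟨_, isTangle_append (isTangle_append hu hm) hc, key m hk⟩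
        ⟨_, isTangle_append (isTangle_append hu hm₁) hc, key m₁ hk₁⟩
        ⟨_, isTangle_append (isTangle_append hu hm₂) hc, key m₂ hk₂⟩ rfl rfl rfl
      rw [← Diagram.wordSkein_word, ← Diagram.wordSkein_word, ← Diagram.wordSkein_word] at h0
      exact h0
    · have key : ∀ x, x.filterMap Slice.knotPart = [] → wordSkein t p (u ++ x ++ v) = 0 := by
        intro x hx
        apply wordSkein_eq_zero'
        simpa [List.filterMap_append, hx] using hw
      rw [key m hk, key m₁ hk₁, key m₂ hk₂, smul_zero, smul_zero, add_zero]
  · have key : ∀ x, IsTangle a x b → wordSkein t p (u ++ x ++ v) = 0 := by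
      intro x hx
      apply wordSkein_eq_zero
      intro h
      obtain ⟨c, h1, h2⟩ := isTangle_append_iff.1 h
      rw [(isTangle_append hu hx).tgt_unique h1] at hc
      exact hc h2
    rw [key m hm, key m₁ hm₁, key m₂ hm₂, smul_zero, smul_zero, add_zero]

theorem skein_crossTrue (d dv dh : Diagram p) (u v : List Slice) (l r : List Colour)
    (hd : d.word = u ++ [⟨l, .cross true .link .link, r⟩] ++ v)
    (hv : dv.word = u ++ [] ++ v)
    (hh : dh.word = u ++ [⟨l, .cap .link, r⟩, ⟨l, .cup .link, r⟩] ++ v) :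
    d.skein t = (t : R) • dv.skein t + ((t⁻¹ : Rˣ) : R) • dh.skein t := by
  rw [List.append_nil] at hv
  have h := mk_eq_zero_of_relator t p (SkeinRelator.crossTrue d dv dh u v l r hd hv hh)
  rw [Submodule.Quotient.mk_sub, Submodule.Quotient.mk_sub, Submodule.Quotient.mk_smul,
    Submodule.Quotient.mk_smul] at h
  rw [sub_sub, sub_eq_zero] at h
  exact h

theorem skein_circle (d d' : Diagram p) (u v : List Slice) (l r : List Colour)
    (hd : d.word = u ++ [⟨l, .cup .link, r⟩, ⟨l, .cap .link, r⟩] ++ v)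
    (hd' : d'.word = u ++ [] ++ v) :
    d.skein t = (-((t ^ 2 : Rˣ) : R)) • d'.skein t + (-((t ^ (-2 : ℤ) : Rˣ) : R)) • d'.skein t := by
  rw [List.append_nil] at hd'
  have h := mk_eq_zero_of_relator t p (SkeinRelator.circle d d' u v l r hd hd')
  rw [Submodule.Quotient.mk_add, Submodule.Quotient.mk_add, Submodule.Quotient.mk_smul,
    Submodule.Quotient.mk_smul, add_assoc, ← eq_neg_iff_add_eq_zero, neg_add] at h
  rw [neg_smul, neg_smul]
  exact h

/-- The functions `u ↦ [u ++ v]` of words `u`, which insert a bottom part `u` below the top part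
`v`, span this module. -/
noncomputable def completions : Submodule R (List Slice → SkeinModule t p) :=
  Submodule.span R (Set.range fun v u => wordSkein t p (u ++ v))

/-- The completion by the top part `v`. -/
noncomputable def completion (v : List Slice) : completions t p :=
  ⟨fun u => wordSkein t p (u ++ v), Submodule.subset_span ⟨v, rfl⟩⟩

/-- The algebra in which words of slices are multiplied by stacking, and in which linear
combinations of words are identified if they define the same skein in every context. -/
def SliceAlg : Type _ := Module.End R (completions t p)

noncomputable instance : Ring (SliceAlg t p) :=
  inferInstanceAs (Ring (Module.End R (completions t p)))

noncomputable instance : Algebra R (SliceAlg t p) :=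
  inferInstanceAs (Algebra R (Module.End R (completions t p)))

variable {t p}

/-- The value of an element of the algebra in the context `u`, `v`. -/
noncomputable def SliceAlg.value (u v : List Slice) : SliceAlg t p →ₗ[R] SkeinModule t p where
  toFun A := (DFunLike.coe (F := Module.End R (completions t p)) A (completion t p v)).1 u
  map_add' _ _ := rfl
  map_smul' _ _ := rfl

theorem completions_end_ext {A B : Module.End R (completions t p)}
    (h : ∀ u v, (A (completion t p v)).1 u = (B (completion t p v)).1 u) : A = B := by
  refine LinearMap.ext fun x => ?_
  obtain ⟨x, hx⟩ := x
  induction hx using Submodule.span_induction with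
  | mem x hx =>
    obtain ⟨v, rfl⟩ := hx
    exact Subtype.ext (funext fun u => h u v)
  | zero =>
    have : (⟨0, zero_mem _⟩ : completions t p) = 0 := rfl
    exact this ▸ (by rw [map_zero, map_zero])
  | add x y hx hy h1 h2 =>
    have : (⟨x + y, add_mem hx hy⟩ : completions t p) = ⟨x, hx⟩ + ⟨y, hy⟩ := rfl
    exact this ▸ (by rw [map_add, map_add, h1, h2])
  | smul r x hx h1 =>
    have : (⟨r • x, Submodule.smul_mem _ r hx⟩ : completions t p) = r • ⟨x, hx⟩ := rfl
    exact this ▸ (by rw [map_smul, map_smul, h1])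

theorem SliceAlg.ext_completion {A B : SliceAlg t p}
    (h : ∀ u v, SliceAlg.value u v A = SliceAlg.value u v B) : A = B :=
  completions_end_ext h

theorem append_mem_completions (w : List Slice) (x : List Slice → SkeinModule t p)
    (hx : x ∈ completions t p) : LinearMap.funLeft R _ (fun u => u ++ w) x ∈ completions t p := by
  induction hx using Submodule.span_induction with
  | mem x hx =>
    obtain ⟨v, rfl⟩ := hx
    refine Submodule.subset_span ⟨w ++ v, ?_⟩
    funext u
    simp [LinearMap.funLeft]
  | zero => rw [map_zero]; exact zero_mem _
  | add x y hx hy h1 h2 => rw [map_add]; exact add_mem h1 h2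
  | smul r x hx h1 => rw [map_smul]; exact Submodule.smul_mem _ r h1

/-- The word `w` as an element of the algebra of slices. -/
noncomputable def op (w : List Slice) : SliceAlg t p :=
  ((LinearMap.funLeft R _ (fun u => u ++ w)).restrict (append_mem_completions w) :
    Module.End R (completions t p))

theorem op_completion (w u v : List Slice) :
    SliceAlg.value u v (op w) = wordSkein t p (u ++ w ++ v) := rfl

theorem op_append (w w' : List Slice) : (op (w ++ w') : SliceAlg t p) = op w * op w' := by
  refine SliceAlg.ext_completion fun u v => ?_
  change wordSkein t p (u ++ (w ++ w') ++ v) = wordSkein t p (u ++ w ++ w' ++ v)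
  simp only [List.append_assoc]

theorem op_nil : (op [] : SliceAlg t p) = 1 := by
  refine SliceAlg.ext_completion fun u v => ?_
  change wordSkein t p (u ++ [] ++ v) = wordSkein t p (u ++ v)
  rw [List.append_nil]

theorem op_cons (s : Slice) (w : List Slice) : (op (s :: w) : SliceAlg t p) = op [s] * op w :=
  op_append [s] w

theorem op_replicate (w : List Slice) (n : ℕ) :
    (op (List.replicate n w).flatten : SliceAlg t p) = op w ^ n := by
  induction n with
  | zero => exact op_nil
  | succ n ih => rw [List.replicate_succ, List.flatten_cons, op_append, ih, pow_succ']

/-- The skein of a closed element of the algebra of slices. -/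
noncomputable def closedSkein : SliceAlg t p →ₗ[R] SkeinModule t p :=
  SliceAlg.value [] []

theorem closedSkein_op (w : List Slice) : closedSkein (op w : SliceAlg t p) = wordSkein t p w := by
  change wordSkein t p ([] ++ w ++ []) = _
  simp

open Classical in
/-- Restriction of functions of words to the words with top end `a`. -/
noncomputable def restrictTop (R : Type*) [CommRing R] (t : Rˣ) (p : ℕ) (a : List Colour) :
    (List Slice → SkeinModule t p) →ₗ[R] (List Slice → SkeinModule t p) where
  toFun f u := if IsTangle [] u a then f u else 0
  map_add' f g := by
    funext u
    by_cases h : IsTangle [] u a <;> simp [h]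
  map_smul' r f := by
    funext u
    by_cases h : IsTangle [] u a <;> simp [h]

theorem restrictTop_mem (a : List Colour) (x : List Slice → SkeinModule t p)
    (hx : x ∈ completions t p) : restrictTop R t p a x ∈ completions t p := by
  induction hx using Submodule.span_induction with
  | mem x hx =>
    obtain ⟨v, rfl⟩ := hx
    by_cases hv : IsTangle a v []
    · refine Submodule.subset_span ⟨v, ?_⟩
      funext u
      simp only [restrictTop, LinearMap.coe_mk, AddHom.coe_mk]
      split_ifs with h
      · rfl
      · refine wordSkein_eq_zero t p fun h' => h ?_
        obtain ⟨c, h1, h2⟩ := isTangle_append_iff.1 h'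
        rwa [hv.src_unique h2]
    · convert zero_mem (completions t p)
      funext u
      simp only [restrictTop, LinearMap.coe_mk, AddHom.coe_mk]
      split_ifs with h
      · refine wordSkein_eq_zero t p fun h' => hv ?_
        obtain ⟨c, h1, h2⟩ := isTangle_append_iff.1 h'
        rwa [h.tgt_unique h1]
      · rfl
  | zero => rw [map_zero]; exact zero_mem _
  | add x y hx hy h1 h2 => rw [map_add]; exact add_mem h1 h2
  | smul r x hx h1 => rw [map_smul]; exact Submodule.smul_mem _ r h1

/-- The trivial braid on the strands `a`. The empty word does not remember its strands, and acts as
the identity of the algebra; `strands a` is the idempotent that does. -/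
noncomputable def strands (a : List Colour) : SliceAlg t p :=
  ((restrictTop R t p a).restrict (restrictTop_mem a) : Module.End R (completions t p))

open Classical in
theorem strands_completion (a : List Colour) (A : SliceAlg t p) (u v : List Slice) :
    SliceAlg.value u v (strands a * A) =
      if IsTangle [] u a then SliceAlg.value u v A else 0 := rfl

theorem strands_mul_op {a b : List Colour} {w : List Slice} (h : IsTangle a w b) (hw : w ≠ []) :
    strands a * (op w : SliceAlg t p) = op w := by
  refine SliceAlg.ext_completion fun u v => ?_
  rw [strands_completion]
  split_ifs with hu
  · rfl
  · rw [op_completion, wordSkein_eq_zero t p]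
    intro h'
    obtain ⟨s, w, rfl⟩ := List.exists_cons_of_ne_nil hw
    obtain ⟨c, h1, h2⟩ := isTangle_append_iff.1 h'
    obtain ⟨d, h3, h4⟩ := isTangle_append_iff.1 h1
    refine hu ?_
    rwa [← h.1, h4.1]

theorem op_mul_strands {a b : List Colour} {w : List Slice} (h : IsTangle a w b) (hw : w ≠ []) :
    (op w : SliceAlg t p) * strands b = op w := by
  refine SliceAlg.ext_completion fun u v => ?_
  change SliceAlg.value (u ++ w) v (strands b) = (completion t p v).1 (u ++ w)
  have h0 := strands_completion b (1 : SliceAlg t p) (u ++ w) v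
  rw [mul_one] at h0
  rw [h0]
  split_ifs with hu
  · rfl
  · refine (wordSkein_eq_zero t p fun h' => hu ?_).symm
    obtain ⟨s, w, rfl⟩ := List.exists_cons_of_ne_nil hw
    obtain ⟨c, h1, h2⟩ := isTangle_append_iff.1 h'
    obtain ⟨d, h3, h4⟩ := isTangle_append_iff.1 h1
    have : a = d := h.1.symm.trans h4.1
    subst this
    exact isTangle_append h3 h

/-- An elementary move is a relation in the algebra of slices. The factor `strands a` is needed since
one of the words may be empty. -/
theorem op_move {m m' : List Slice} (a : List Colour) {b : List Colour} (h : LocalMove m m')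
    (hm : IsTangle a m b) (hm' : IsTangle a m' b)
    (hk : m.filterMap Slice.knotPart = m'.filterMap Slice.knotPart) :
    strands a * (op m : SliceAlg t p) = strands a * op m' := by
  refine SliceAlg.ext_completion fun u v => ?_
  rw [strands_completion, strands_completion]
  split_ifs with hu
  · exact wordSkein_move t p hu hm hm' h hk
  · rfl

theorem op_crossTrue (l r : List Colour) :
    (op [⟨l, .cross true .link .link, r⟩] : SliceAlg t p) =
      (t : R) • strands (l ++ [.link, .link] ++ r) +
        ((t⁻¹ : Rˣ) : R) • op [⟨l, .cap .link, r⟩, ⟨l, .cup .link, r⟩] := by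
  have h1 : IsTangle (l ++ [.link, .link] ++ r) [⟨l, .cross true .link .link, r⟩]
    (l ++ [.link, .link] ++ r) := ⟨rfl, rfl⟩
  have h2 : IsTangle (l ++ [.link, .link] ++ r) [⟨l, .cap .link, r⟩, ⟨l, .cup .link, r⟩]
    (l ++ [.link, .link] ++ r) := ⟨rfl, rfl, rfl⟩
  rw [← strands_mul_op h1 (by simp), ← strands_mul_op h2 (by simp),
    ← mul_one ((t : R) • strands _), smul_mul_assoc, ← mul_smul_comm, ← mul_smul_comm, ← mul_add]
  refine SliceAlg.ext_completion fun u v => ?_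
  rw [strands_completion, strands_completion]
  split_ifs with hu
  · have := wordSkein_linear t p (v := v) hu h1 (m₁ := []) rfl h2 rfl rfl rfl (t : R) ((t⁻¹ : Rˣ) : R)
      fun d dv dh => skein_crossTrue t p d dv dh u v l r
    rw [List.append_nil] at this
    exact this
  · rfl

theorem op_circle (l r : List Colour) :
    (op [⟨l, .cup .link, r⟩, ⟨l, .cap .link, r⟩] : SliceAlg t p) =
      (-((t ^ 2 : Rˣ) : R) - ((t ^ (-2 : ℤ) : Rˣ) : R)) • strands (l ++ r) := by
  have h1 : IsTangle (l ++ r) [⟨l, .cup .link, r⟩, ⟨l, .cap .link, r⟩] (l ++ r) := by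
    refine ⟨?_, rfl, ?_⟩ <;> simp [IsTangle, Slice.src, Slice.tgt, Gen.src, Gen.tgt]
  rw [← strands_mul_op h1 (by simp), ← mul_one ((_ : R) • strands _), smul_mul_assoc,
    ← mul_smul_comm]
  refine SliceAlg.ext_completion fun u v => ?_
  rw [strands_completion, strands_completion]
  split_ifs with hu
  · have := wordSkein_linear t p (v := v) hu h1 (m₁ := []) (m₂ := []) rfl rfl rfl rfl rfl
      (-((t ^ 2 : Rˣ) : R)) (-((t ^ (-2 : ℤ) : Rˣ) : R))
      fun d d' d'' h h' h'' => by
        obtain rfl : d' = d'' := by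
          cases d'
          cases d''
          simp_all
        exact skein_circle t p d d' u v l r h h'
    rw [List.append_nil, ← add_smul, ← sub_eq_add_neg] at this
    exact this
  · rfl

end

open Colour

/-! ### Elementary moves in the algebra of slices -/

section
variable {R : Type*} [CommRing R] {t : Rˣ} {p : ℕ}

/-- Is the generator a part of the fixed diagram of the knot? -/
def Gen.isPinned : Gen → Bool
  | .cup c => c.isKnot
  | .cap c => c.isKnot
  | .cross _ a b => a.isKnot && b.isKnot

theorem Slice.knotPart_of_not_isPinned {g : Gen} (h : g.isPinned = false) (l r : List Colour) :
    Slice.knotPart ⟨l, g, r⟩ = none := by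
  rcases g with (_ | _) | (_ | _) | ⟨e, _ | _, _ | _⟩ <;> first | rfl | cases h

theorem Gen.filter_src_of_not_isPinned {g : Gen} (h : g.isPinned = false) :
    g.src.filter Colour.isKnot = g.tgt.filter Colour.isKnot := by
  rcases g with (_ | _) | (_ | _) | ⟨e, _ | _, _ | _⟩ <;> first | rfl | cases h

theorem Slice.knotPart_congr {l l' r r' : List Colour} (g : Gen)
    (hl : l.filter Colour.isKnot = l'.filter Colour.isKnot)
    (hr : r.filter Colour.isKnot = r'.filter Colour.isKnot) :
    Slice.knotPart ⟨l, g, r⟩ = Slice.knotPart ⟨l', g, r'⟩ := by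
  rcases g with (_ | _) | (_ | _) | ⟨e, _ | _, _ | _⟩ <;> simp [Slice.knotPart, hl, hr]

/-- The elementary slice with generator `g` in the algebra of slices. The strands on its left are
given in two parts, so that computations can be done with an arbitrary number of further strands
`L` on the left. -/
noncomputable def slice (L l : List Colour) (g : Gen) (r : List Colour) : SliceAlg t p :=
  op [⟨L ++ l, g, r⟩]

theorem op_pair (s s' : Slice) : (op [s, s'] : SliceAlg t p) = op [s] * op [s'] :=
  op_cons _ _

theorem op_triple (s s' s'' : Slice) :
    (op [s, s', s''] : SliceAlg t p) = op [s] * (op [s'] * op [s'']) := by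
  rw [op_cons, op_pair]

theorem op_cons_slice (l : List Colour) (g : Gen) (r : List Colour) (w : List Slice) :
    (op (⟨l, g, r⟩ :: w) : SliceAlg t p) = slice [] l g r * op w :=
  op_cons _ _

theorem slice_append (L L' l : List Colour) (g : Gen) (r : List Colour) :
    (slice (L ++ L') l g r : SliceAlg t p) = slice L (L' ++ l) g r := by
  unfold slice
  rw [List.append_assoc]

theorem strands_mul_slice (L l : List Colour) (g : Gen) (r : List Colour) :
    strands (L ++ (l ++ (g.src ++ r))) * (slice L l g r : SliceAlg t p) = slice L l g r := by
  refine strands_mul_op (b := (⟨L ++ l, g, r⟩ : Slice).tgt) ⟨?_, rfl⟩ (by simp)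
  simp [Slice.src]

theorem slice_mul_strands (L l : List Colour) (g : Gen) (r : List Colour) :
    (slice L l g r : SliceAlg t p) * strands (L ++ (l ++ (g.tgt ++ r))) = slice L l g r := by
  refine op_mul_strands (a := (⟨L ++ l, g, r⟩ : Slice).src) ⟨rfl, ?_⟩ (by simp)
  simp [Slice.tgt, IsTangle]

theorem strands_mul_slice' (L l : List Colour) (g : Gen) (r : List Colour) (z : SliceAlg t p) :
    strands (L ++ (l ++ (g.src ++ r))) * (slice L l g r * z) = slice L l g r * z := by
  rw [← mul_assoc, strands_mul_slice]

theorem slice_mul_strands' (L l : List Colour) (g : Gen) (r : List Colour) (z : SliceAlg t p) :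
    slice L l g r * (strands (L ++ (l ++ (g.tgt ++ r))) * z) = slice L l g r * z := by
  rw [← mul_assoc, slice_mul_strands]

/-- Two generators side by side can be interchanged, except when both of them are parts of the fixed
diagram of the knot. -/
theorem exchange (L l m r : List Colour) (g h : Gen) (z : SliceAlg t p)
    (hf : (g.isPinned && h.isPinned) = false := by rfl) :
    slice L l g (m ++ (h.src ++ r)) * (slice L (l ++ (g.tgt ++ m)) h r * z) =
      slice L (l ++ (g.src ++ m)) h r * (slice L l g (m ++ (h.tgt ++ r)) * z) := by
  have hm := LocalMove.exchange (L ++ l) m r g h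
  have h1 : IsTangle (L ++ l ++ g.src ++ m ++ h.src ++ r)
      [⟨L ++ l, g, m ++ h.src ++ r⟩, ⟨L ++ l ++ g.tgt ++ m, h, r⟩]
      (L ++ l ++ g.tgt ++ m ++ h.tgt ++ r) := by
    refine ⟨?_, ?_, ?_⟩ <;> simp [Slice.src, Slice.tgt, IsTangle]
  have h2 : IsTangle (L ++ l ++ g.src ++ m ++ h.src ++ r)
      [⟨L ++ l ++ g.src ++ m, h, r⟩, ⟨L ++ l, g, m ++ h.tgt ++ r⟩]
      (L ++ l ++ g.tgt ++ m ++ h.tgt ++ r) := by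
    refine ⟨?_, ?_, ?_⟩ <;> simp [Slice.src, Slice.tgt, IsTangle]
  have hk : [(⟨L ++ l, g, m ++ h.src ++ r⟩ : Slice), ⟨L ++ l ++ g.tgt ++ m, h, r⟩].filterMap
      Slice.knotPart = [(⟨L ++ l ++ g.src ++ m, h, r⟩ : Slice),
        ⟨L ++ l, g, m ++ h.tgt ++ r⟩].filterMap Slice.knotPart := by
    rcases Bool.and_eq_false_iff.1 hf with hg | hh
    · have := Slice.knotPart_congr (l := L ++ l ++ g.tgt ++ m) (l' := L ++ l ++ g.src ++ m)
        (r := r) h (by simp [Gen.filter_src_of_not_isPinned hg]) rfl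
      simp only [List.filterMap_cons, Slice.knotPart_of_not_isPinned hg, this]
    · have := Slice.knotPart_congr (l := L ++ l) (r := m ++ h.src ++ r) (r' := m ++ h.tgt ++ r) g rfl
        (by simp [Gen.filter_src_of_not_isPinned hh])
      simp only [List.filterMap_cons, Slice.knotPart_of_not_isPinned hh, this]
  have := op_move (t := t) (p := p) _ hm h1 h2 hk
  rw [strands_mul_op h1 (by simp), strands_mul_op h2 (by simp), op_pair, op_pair] at this
  rw [← mul_assoc, ← mul_assoc]
  simp only [slice, List.append_assoc] at this ⊢
  rw [this]

theorem zig (L l r : List Colour) (z : SliceAlg t p) :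
    slice L l (.cup link) (link :: r) * (slice L (l ++ [link]) (.cap link) r * z) =
      strands (L ++ (l ++ link :: r)) * z := by
  have hm := LocalMove.zig (L ++ l) r link
  have h1 : IsTangle (L ++ (l ++ link :: r))
      [⟨L ++ l, .cup link, [link] ++ r⟩, ⟨L ++ l ++ [link], .cap link, r⟩]
      (L ++ (l ++ link :: r)) := by
    refine ⟨?_, ?_, ?_⟩ <;> simp [Slice.src, Slice.tgt, Gen.src, Gen.tgt, IsTangle]
  have := op_move (t := t) (p := p) _ hm h1 rfl rfl
  rw [strands_mul_op h1 (by simp), op_pair, op_nil, mul_one] at this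
  rw [← this, mul_assoc]
  simp only [slice, List.append_assoc, List.singleton_append]

theorem zag (L l r : List Colour) (z : SliceAlg t p) :
    slice L (l ++ [link]) (.cup link) r * (slice L l (.cap link) (link :: r) * z) =
      strands (L ++ (l ++ link :: r)) * z := by
  have hm := LocalMove.zag (L ++ l) r link
  have h1 : IsTangle (L ++ (l ++ link :: r))
      [⟨L ++ l ++ [link], .cup link, r⟩, ⟨L ++ l, .cap link, [link] ++ r⟩]
      (L ++ (l ++ link :: r)) := by
    refine ⟨?_, ?_, ?_⟩ <;> simp [Slice.src, Slice.tgt, Gen.src, Gen.tgt, IsTangle]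
  have := op_move (t := t) (p := p) _ hm h1 rfl rfl
  rw [strands_mul_op h1 (by simp), op_pair, op_nil, mul_one] at this
  rw [← this, mul_assoc]
  simp only [slice, List.append_assoc, List.singleton_append]

theorem reidemeister2 (L l r : List Colour) (a b : Colour) (e : Bool) (z : SliceAlg t p)
    (hf : (a.isKnot && b.isKnot) = false := by rfl) :
    slice L l (.cross e a b) r * (slice L l (.cross (!e) b a) r * z) =
      strands (L ++ (l ++ a :: b :: r)) * z := by
  have hm := LocalMove.reidemeister2 (L ++ l) r a b e
  have h1 : IsTangle (L ++ (l ++ a :: b :: r))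
      [⟨L ++ l, .cross e a b, r⟩, ⟨L ++ l, .cross (!e) b a, r⟩] (L ++ (l ++ a :: b :: r)) := by
    refine ⟨?_, ?_, ?_⟩ <;> simp [Slice.src, Slice.tgt, Gen.src, Gen.tgt, IsTangle]
  have := op_move (t := t) (p := p) _ hm h1 rfl (by
    have h2 : Gen.isPinned (.cross e a b) = false := hf
    have h3 : Gen.isPinned (.cross (!e) b a) = false := (Bool.and_comm _ _).trans hf
    simp only [List.filterMap_cons, Slice.knotPart_of_not_isPinned h2,
      Slice.knotPart_of_not_isPinned h3])
  rw [strands_mul_op h1 (by simp), op_pair, op_nil, mul_one] at this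
  rw [← this, mul_assoc]
  rfl

theorem reidemeister3 (L l r : List Colour) (a b c : Colour) (ab ac bc : Bool) (z : SliceAlg t p)
    (levels : ab = bc → ac = ab := by simp)
    (hf : [a, b, c].count link ≠ 0 := by decide) :
    slice L l (.cross ab a b) (c :: r) * (slice L (l ++ [b]) (.cross ac a c) r *
        (slice L l (.cross bc b c) (a :: r) * z)) =
      slice L (l ++ [a]) (.cross bc b c) r * (slice L l (.cross ac a c) (b :: r) *
        (slice L (l ++ [c]) (.cross ab a b) r * z)) := by
  have hm := LocalMove.reidemeister3 (L ++ l) r a b c ab ac bc levels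
  have h1 : IsTangle (L ++ (l ++ a :: b :: c :: r))
      [⟨L ++ l, .cross ab a b, [c] ++ r⟩, ⟨L ++ l ++ [b], .cross ac a c, r⟩,
        ⟨L ++ l, .cross bc b c, [a] ++ r⟩] (L ++ (l ++ c :: b :: a :: r)) := by
    refine ⟨?_, ?_, ?_, ?_⟩ <;> simp [Slice.src, Slice.tgt, Gen.src, Gen.tgt, IsTangle]
  have h2 : IsTangle (L ++ (l ++ a :: b :: c :: r))
      [⟨L ++ l ++ [a], .cross bc b c, r⟩, ⟨L ++ l, .cross ac a c, [b] ++ r⟩,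
        ⟨L ++ l ++ [c], .cross ab a b, r⟩] (L ++ (l ++ c :: b :: a :: r)) := by
    refine ⟨?_, ?_, ?_, ?_⟩ <;> simp [Slice.src, Slice.tgt, Gen.src, Gen.tgt, IsTangle]
  have := op_move (t := t) (p := p) _ hm h1 h2 (by
    rcases a with _ | _ <;> rcases b with _ | _ <;> rcases c with _ | _ <;>
      first
      | exact absurd rfl hf
      | rfl
      | simp [List.filterMap_cons, Slice.knotPart, Colour.isKnot])
  rw [strands_mul_op h1 (by simp), strands_mul_op h2 (by simp)] at this
  rw [op_triple, op_triple] at this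
  have := congrArg (· * z) this
  simp only [slice, List.append_assoc, List.singleton_append, mul_assoc] at this ⊢
  exact this

theorem slideCup (L l r : List Colour) (a c : Colour) (e : Bool) (z : SliceAlg t p)
    (hf : (a.isKnot && c.isKnot) = false := by rfl) :
    slice L (l ++ [a]) (.cup c) r * (slice L l (.cross e a c) (c :: r) *
        (slice L (l ++ [c]) (.cross e a c) r * z)) = slice L l (.cup c) (a :: r) * z := by
  have hm := LocalMove.slideCup (L ++ l) r a c e
  have h1 : IsTangle (L ++ (l ++ a :: r))
      [⟨L ++ l ++ [a], .cup c, r⟩, ⟨L ++ l, .cross e a c, [c] ++ r⟩,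
        ⟨L ++ l ++ [c], .cross e a c, r⟩] (L ++ (l ++ c :: c :: a :: r)) := by
    refine ⟨?_, ?_, ?_, ?_⟩ <;> simp [Slice.src, Slice.tgt, Gen.src, Gen.tgt, IsTangle]
  have h2 : IsTangle (L ++ (l ++ a :: r))
      [⟨L ++ l, .cup c, [a] ++ r⟩] (L ++ (l ++ c :: c :: a :: r)) := by
    refine ⟨?_, ?_⟩ <;> simp [Slice.src, Slice.tgt, Gen.src, Gen.tgt, IsTangle]
  have := op_move (t := t) (p := p) _ hm h1 h2 (by
    rcases a with _ | _ <;> rcases c with _ | _ <;>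
      first
      | exact absurd hf (by decide)
      | rfl
      | simp [List.filterMap_cons, Slice.knotPart, Colour.isKnot])
  rw [strands_mul_op h1 (by simp), strands_mul_op h2 (by simp)] at this
  rw [op_triple] at this
  have := congrArg (· * z) this
  simp only [slice, List.append_assoc, List.singleton_append, mul_assoc] at this ⊢
  exact this

theorem slideCap (L l r : List Colour) (a c : Colour) (e : Bool) (z : SliceAlg t p)
    (hf : (a.isKnot && c.isKnot) = false := by rfl) :
    slice L l (.cross e a c) (c :: r) * (slice L (l ++ [c]) (.cross e a c) r *
        (slice L l (.cap c) (a :: r) * z)) = slice L (l ++ [a]) (.cap c) r * z := by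
  have hm := LocalMove.slideCap (L ++ l) r a c e
  have h1 : IsTangle (L ++ (l ++ a :: c :: c :: r))
      [⟨L ++ l, .cross e a c, [c] ++ r⟩, ⟨L ++ l ++ [c], .cross e a c, r⟩,
        ⟨L ++ l, .cap c, [a] ++ r⟩] (L ++ (l ++ a :: r)) := by
    refine ⟨?_, ?_, ?_, ?_⟩ <;> simp [Slice.src, Slice.tgt, Gen.src, Gen.tgt, IsTangle]
  have h2 : IsTangle (L ++ (l ++ a :: c :: c :: r))
      [⟨L ++ l ++ [a], .cap c, r⟩] (L ++ (l ++ a :: r)) := by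
    refine ⟨?_, ?_⟩ <;> simp [Slice.src, Slice.tgt, Gen.src, Gen.tgt, IsTangle]
  have := op_move (t := t) (p := p) _ hm h1 h2 (by
    rcases a with _ | _ <;> rcases c with _ | _ <;>
      first
      | exact absurd hf (by decide)
      | rfl
      | simp [List.filterMap_cons, Slice.knotPart, Colour.isKnot])
  rw [strands_mul_op h1 (by simp), strands_mul_op h2 (by simp)] at this
  rw [op_triple] at this
  have := congrArg (· * z) this
  simp only [slice, List.append_assoc, List.singleton_append, mul_assoc] at this ⊢
  exact this

theorem resolve (L l r : List Colour) (z : SliceAlg t p) :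
    slice L l (.cross true link link) r * z =
      (t : R) • (strands (L ++ (l ++ link :: link :: r)) * z) +
        ((t⁻¹ : Rˣ) : R) • (slice L l (.cap link) r * (slice L l (.cup link) r * z)) := by
  unfold slice
  rw [op_crossTrue, op_cons]
  simp only [add_mul, smul_mul_assoc, mul_assoc, List.append_assoc, List.cons_append,
    List.nil_append]

theorem circle (L l r : List Colour) (z : SliceAlg t p) :
    slice L l (.cup link) r * (slice L l (.cap link) r * z) =
      (-((t ^ 2 : Rˣ) : R) - ((t ^ (-2 : ℤ) : Rˣ) : R)) • (strands (L ++ (l ++ r)) * z) := by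
  unfold slice
  rw [← mul_assoc, ← op_append, List.singleton_append, op_circle, smul_mul_assoc,
    List.append_assoc]

-- The unifier is to see the arguments of `slice` up to computation with lists of strands, but not
-- the words behind it.
attribute [irreducible] slice

theorem cup_slide (L l r : List Colour) (a c : Colour) (e : Bool) (z : SliceAlg t p)
    (hf : (a.isKnot && c.isKnot) = false := by rfl) :
    slice L (l ++ [a]) (.cup c) r * (slice L l (.cross e a c) (c :: r) * z) =
      slice L l (.cup c) (a :: r) * (slice L (l ++ [c]) (.cross (!e) c a) r * z) := by
  rw [← slideCup L l r a c e _ hf, reidemeister2 L (l ++ [c]) r a c e z hf]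
  congr 1
  have := slice_mul_strands' L l (.cross e a c) (c :: r) z
  simp only [Gen.tgt, List.append_assoc, List.cons_append, List.nil_append] at this ⊢
  rw [this]

theorem cap_slide (L l r : List Colour) (a c : Colour) (e : Bool) (z : SliceAlg t p)
    (hf : (a.isKnot && c.isKnot) = false := by rfl) :
    slice L (l ++ [c]) (.cross e a c) r * (slice L l (.cap c) (a :: r) * z) =
      slice L l (.cross (!e) c a) (c :: r) * (slice L (l ++ [a]) (.cap c) r * z) := by
  have h2 := reidemeister2 L l (c :: r) c a (!e)
    (slice L (l ++ [c]) (.cross e a c) r * (slice L l (.cap c) (a :: r) * z))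
    (by rw [← hf]; exact Bool.and_comm _ _)
  rw [Bool.not_not] at h2
  rw [← slideCap L l r a c e z hf, h2]
  have := strands_mul_slice' L (l ++ [c]) (.cross e a c) r (slice L l (.cap c) (a :: r) * z)
  simp only [Gen.src, List.append_assoc, List.cons_append, List.nil_append] at this ⊢
  rw [this]

end

/-! ### Winding strands and curves around strands of the knot -/

section
variable {R : Type*} [CommRing R] {t : Rˣ} {p : ℕ}

/-- A curl in a framed arc amounts to the factor `-t³`. -/
theorem kink (L l r : List Colour) (z : SliceAlg t p) :
    slice L l (.cup link) (link :: r) * (slice L (l ++ [link]) (.cross true link link) r *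
        (slice L l (.cap link) (link :: r) * z)) =
      (-((t ^ 3 : Rˣ) : R)) • (strands (L ++ (l ++ link :: r)) * z) := by
  have h1 := strands_mul_slice' (t := t) L l (.cap link) (link :: r) z
  have h2 := circle (t := t) L l (link :: r) z
  have h3 := zag L l r (slice L (l ++ [link]) (.cap link) r *
    (slice L (l ++ [link]) (.cup link) r * (slice L l (.cap link) (link :: r) * z)))
  have h4 := zig (t := t) L l r z
  simp only [Gen.src, List.cons_append, List.nil_append] at h1
  rw [resolve]
  simp only [List.append_assoc, List.cons_append, List.nil_append, mul_add, mul_smul_comm]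
  have h5 := zig L l r (slice L (l ++ [link]) (.cup link) r *
    (slice L l (.cap link) (link :: r) * z))
  have h6 := zag L l r z
  have h7 := strands_mul_slice' (t := t) L (l ++ [link]) (.cup link) r
    (slice L l (.cap link) (link :: r) * z)
  simp only [Gen.src, List.append_assoc, List.cons_append, List.nil_append] at h7
  rw [h1, h2, h5, h7, h6, smul_smul, ← add_smul]
  congr 1
  have e1 : ((t ^ 3 : Rˣ) : R) = (t : R) * ((t ^ 2 : Rˣ) : R) := by
    rw [← Units.val_mul, ← pow_succ']
  have e2 : ((t⁻¹ : Rˣ) : R) = (t : R) * ((t ^ (-2 : ℤ) : Rˣ) : R) := by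
    rw [← Units.val_mul]
    congr 1
    group
  rw [e1, e2]
  ring

/-- The link strand to the right of a knot strand runs once around it: in front of it and then back
behind it for `e = true`, and the other way round for `e = false`. These two are inverse to each
other. -/
noncomputable def wind (e : Bool) (L r : List Colour) : SliceAlg t p :=
  slice L [] (.cross (!e) knot link) r * slice L [] (.cross (!e) link knot) r

/-- The meridian of a knot strand. -/
noncomputable def loop (e : Bool) (L r : List Colour) : SliceAlg t p :=
  slice L [knot] (.cup link) r * (slice L [] (.cross (!e) knot link) (link :: r) *
    (slice L [] (.cross (!e) link knot) (link :: r) * slice L [knot] (.cap link) r))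

theorem loop_eq_left (e : Bool) (L r : List Colour) :
    (loop e L r : SliceAlg t p) =
      slice L [] (.cup link) (knot :: r) * (slice L [link] (.cross e link knot) r *
        (slice L [link] (.cross e knot link) r * slice L [] (.cap link) (knot :: r))) := by
  have h1 := cup_slide (t := t) (p := p) L [] r knot link (!e)
  have h2 := cap_slide (t := t) (p := p) L [] r knot link e 1
  simp only [List.nil_append, mul_one, Bool.not_not] at h1 h2
  rw [h2, ← h1]
  rfl

/-- A meridian next to a link strand is a combination of the two ways in which the strand can wind
around the knot. A positive crossing between the meridian and the strand is evaluated twice: one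
smoothing splits off the meridian and the other makes the strand wind around the knot, but as a
whole the tangle is a strand that winds around the knot the other way, with a curl. -/
theorem loop_eq_wind (L r : List Colour) :
    (loop true L (link :: r) : SliceAlg t p) =
      -(((t ^ (-2 : ℤ) : Rˣ) : R) • wind true L r) - ((t ^ 2 : Rˣ) : R) • wind false L r := by
  have h1 : slice L [knot] (.cup link) (link :: r) *
      (slice L [] (.cross false knot link) (link :: link :: r) *
      (slice L [] (.cross false link knot) (link :: link :: r) *
      (slice L [knot, link] (.cross true link link) r *
      (slice L [knot] (.cap link) (link :: r) * 1)))) = (t : R) • (loop true L (link :: r) : SliceAlg t p) +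
        ((t⁻¹ : Rˣ) : R) • wind true L r := by
    rw [resolve]
    simp only [mul_add, mul_smul_comm]
    congr 2
    · erw [strands_mul_slice' L [knot] (.cap link) (link :: r)]
      rw [mul_one]
      rfl
    · erw [zag L [knot] r 1]
      rw [mul_one]
      erw [slice_mul_strands L [knot,link] (.cap link) r, ← mul_one (slice L [knot,link] (.cap link) r),
        exchange L [] [] r (.cross false link knot) (.cap link),
        exchange L [] [] r (.cross false knot link) (.cap link), zig L [knot] r, mul_one,
        ← mul_assoc, strands_mul_slice L [] (.cross false knot link) r]
      rfl
  have h2 : slice L [knot] (.cup link) (link :: r) *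
      (slice L [] (.cross false knot link) (link :: link :: r) *
      (slice L [] (.cross false link knot) (link :: link :: r) *
      (slice L [knot, link] (.cross true link link) r *
      (slice L [knot] (.cap link) (link :: r) * 1)))) =
        (-((t ^ 3 : Rˣ) : R)) • (wind false L r : SliceAlg t p) := by
    erw [exchange L [] [] r (.cross false link knot) (.cross true link link),
      ← cap_slide L [] (link :: r) knot link true, cup_slide L [] (link :: r) knot link false,
      reidemeister3 L [link] r link knot link true true true,
      exchange L [] [] r (.cup link) (.cross true knot link),
      ← exchange L [] [] r (.cap link) (.cross true link knot), kink L [] (knot :: r)]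
    rw [mul_one, mul_smul_comm]
    erw [strands_mul_slice L [] (.cross true link knot) r]
    rfl
  have h3 := congrArg (fun A => ((t⁻¹ : Rˣ) : R) • A) (h1.symm.trans h2)
  simp only [smul_add, smul_smul] at h3
  rw [← Units.val_mul, ← Units.val_mul, inv_mul_cancel, Units.val_one, one_smul, mul_neg,
    ← Units.val_mul] at h3
  have e1 : t⁻¹ * t⁻¹ = t ^ (-2 : ℤ) := by group
  have e2 : t⁻¹ * t ^ 3 = t ^ 2 := by group
  rw [e1, e2] at h3
  have h4 := eq_sub_of_add_eq (G := SliceAlg t p) h3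
  rw [h4]
  module

/-- The link strand to the right of two knot strands runs once around both of them. -/
noncomputable def windPair (e : Bool) (L r : List Colour) : SliceAlg t p :=
  slice L [knot] (.cross (!e) knot link) r * (slice L [] (.cross (!e) knot link) (knot :: r) *
    (slice L [] (.cross (!e) link knot) (knot :: r) * slice L [knot] (.cross (!e) link knot) r))

/-- The curve around two knot strands. -/
noncomputable def loopPair (L r : List Colour) : SliceAlg t p :=
  slice L [knot, knot] (.cup link) r * (slice L [knot] (.cross false knot link) (link :: r) *
    (slice L [] (.cross false knot link) (knot :: link :: r) *
    (slice L [] (.cross false link knot) (knot :: link :: r) *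
    (slice L [knot] (.cross false link knot) (link :: r) * slice L [knot, knot] (.cap link) r))))

theorem loopPair_eq_left (L r : List Colour) :
    (loopPair L r : SliceAlg t p) =
      slice L [] (.cup link) (knot :: knot :: r) *
        (slice L [link] (.cross true link knot) (knot :: r) *
        (slice L [link, knot] (.cross true link knot) r *
        (slice L [link, knot] (.cross true knot link) r *
        (slice L [link] (.cross true knot link) (knot :: r) *
        slice L [] (.cap link) (knot :: knot :: r))))) := by
  have h1 : (loopPair L r : SliceAlg t p) = loopPair L r * 1 := (mul_one _).symm
  rw [h1]
  unfold loopPair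
  simp only [mul_assoc]
  erw [← cap_slide L [knot] r knot link true,
    exchange L [] [] r (.cross false link knot) (.cross true knot link),
    ← cap_slide L [] (knot :: r) knot link true, cup_slide L [knot] r knot link false,
    ← exchange L [] [] r (.cross false knot link) (.cross true link knot),
    cup_slide L [] (knot :: r) knot link false]
  rw [mul_one]
  rfl

/-- The analogue of `loop_eq_wind` for the curve around two strands of the knot. -/
theorem loopPair_eq_wind (L r : List Colour) :
    (loopPair L (link :: r) : SliceAlg t p) =
      -(((t ^ (-2 : ℤ) : Rˣ) : R) • windPair true L r) -
        ((t ^ 2 : Rˣ) : R) • windPair false L r := by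
  have h1 : slice L [knot, knot] (.cup link) (link :: r) *
      (slice L [knot] (.cross false knot link) (link :: link :: r) *
      (slice L [] (.cross false knot link) (knot :: link :: link :: r) *
      (slice L [] (.cross false link knot) (knot :: link :: link :: r) *
      (slice L [knot] (.cross false link knot) (link :: link :: r) *
      (slice L [knot, knot, link] (.cross true link link) r *
      (slice L [knot, knot] (.cap link) (link :: r) * 1)))))) =
        (t : R) • (loopPair L (link :: r) : SliceAlg t p) +
          ((t⁻¹ : Rˣ) : R) • windPair true L r := by
    rw [resolve]
    simp only [mul_add, mul_smul_comm]
    congr 2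
    · erw [strands_mul_slice' L [knot, knot] (.cap link) (link :: r)]
      rw [mul_one]
      rfl
    · erw [zag L [knot, knot] r 1]
      rw [mul_one]
      erw [slice_mul_strands L [knot, knot, link] (.cap link) r,
        ← mul_one (slice L [knot, knot, link] (.cap link) r),
        exchange L [knot] [] r (.cross false link knot) (.cap link),
        exchange L [] [knot] r (.cross false link knot) (.cap link),
        exchange L [] [knot] r (.cross false knot link) (.cap link),
        exchange L [knot] [] r (.cross false knot link) (.cap link), zig L [knot, knot] r, mul_one,
        ← mul_assoc, strands_mul_slice L [knot] (.cross false knot link) r]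
      rfl
  have h2 : slice L [knot, knot] (.cup link) (link :: r) *
      (slice L [knot] (.cross false knot link) (link :: link :: r) *
      (slice L [] (.cross false knot link) (knot :: link :: link :: r) *
      (slice L [] (.cross false link knot) (knot :: link :: link :: r) *
      (slice L [knot] (.cross false link knot) (link :: link :: r) *
      (slice L [knot, knot, link] (.cross true link link) r *
      (slice L [knot, knot] (.cap link) (link :: r) * 1)))))) =
        (-((t ^ 3 : Rˣ) : R)) • (windPair false L r : SliceAlg t p) := by
    erw [exchange L [knot] [] r (.cross false link knot) (.cross true link link),
      exchange L [] [knot] r (.cross false link knot) (.cross true link link),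
      ← cap_slide L [knot] (link :: r) knot link true,
      exchange L [] [] (link :: r) (.cross false link knot) (.cross true knot link),
      ← cap_slide L [] (knot :: link :: r) knot link true,
      cup_slide L [knot] (link :: r) knot link false,
      ← exchange L [] [] (link :: r) (.cross false knot link) (.cross true link knot),
      cup_slide L [] (knot :: link :: r) knot link false,
      reidemeister3 L [link, knot] r link knot link true true true,
      exchange L [link] [] r (.cross true link knot) (.cross true knot link),
      ← exchange L [link] [] r (.cross true knot link) (.cross true link knot),
      reidemeister3 L [link] (knot :: r) link knot link true true true,
      exchange L [] [knot] r (.cup link) (.cross true knot link),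
      exchange L [] [] (knot :: r) (.cup link) (.cross true knot link),
      ← exchange L [] [knot] r (.cap link) (.cross true link knot),
      ← exchange L [] [] (knot :: r) (.cap link) (.cross true link knot),
      kink L [] (knot :: knot :: r)]
    rw [mul_one, mul_smul_comm, mul_smul_comm]
    erw [strands_mul_slice' L [] (.cross true link knot) (knot :: r)]
    rfl
  have h3 := congrArg (fun A => ((t⁻¹ : Rˣ) : R) • A) (h1.symm.trans h2)
  simp only [smul_add, smul_smul] at h3
  rw [← Units.val_mul, ← Units.val_mul, inv_mul_cancel, Units.val_one, one_smul, mul_neg,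
    ← Units.val_mul] at h3
  have e1 : t⁻¹ * t⁻¹ = t ^ (-2 : ℤ) := by group
  have e2 : t⁻¹ * t ^ 3 = t ^ 2 := by group
  rw [e1, e2] at h3
  have h4 := eq_sub_of_add_eq (G := SliceAlg t p) h3
  rw [h4]
  module

end

/-! ### Curves around strands and the crossings of the braid -/

section
variable {R : Type*} [CommRing R] {t : Rˣ} {p : ℕ}

theorem slice_singleton (c : Colour) (l : List Colour) (g : Gen) (r : List Colour) :
    (slice [c] l g r : SliceAlg t p) = slice [] (c :: l) g r :=
  slice_append [] [c] l g r

theorem SliceAlg.ext_mul {A B : SliceAlg t p} (h : ∀ z, A * z = B * z) : A = B := by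
  simpa only [mul_one] using h 1

/-- If `x` is resolved as `-a w - a⁻¹ w'`, then conversely `w'` is resolved as `-a x - a² w`. -/
theorem conj_eq_of_eq_neg_sub {A : Type*} [Ring A] [Algebra R A] {x w w' : A} {a b c : R}
    (h : x = -(a • w) - b • w') (hab : a * b = 1) (hc : c = a * a) (u v : A) :
    u * (w' * v) = -(a • (u * (x * v))) - c • (u * (w * v)) := by
  rw [h, hc]
  simp only [sub_mul, mul_sub, neg_mul, mul_neg, smul_mul_assoc, mul_smul_comm, smul_sub, smul_neg,
    smul_smul, hab, one_smul]
  abel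

theorem strands_mul_loop (e : Bool) (L r : List Colour) :
    strands (L ++ knot :: r) * (loop e L r : SliceAlg t p) = loop e L r :=
  strands_mul_slice' L [knot] (.cup link) r _

theorem loop_comm_right (e : Bool) (L m r : List Colour) (g : Gen) (z : SliceAlg t p) :
    loop e L (m ++ (g.src ++ r)) * (slice L (knot :: m) g r * z) =
      slice L (knot :: m) g r * (loop e L (m ++ (g.tgt ++ r)) * z) := by
  rw [loop_eq_left, loop_eq_left]
  simp only [mul_assoc]
  erw [exchange L [] (knot :: m) r (.cap link) g, exchange L [link] m r (.cross e knot link) g,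
    exchange L [link] m r (.cross e link knot) g, exchange L [] (knot :: m) r (.cup link) g]
  rfl

theorem loop_comm_left (e : Bool) (L l m s : List Colour) (g : Gen) (z : SliceAlg t p) :
    slice L l g (m ++ knot :: s) * (loop e (L ++ (l ++ (g.tgt ++ m))) s * z) =
      loop e (L ++ (l ++ (g.src ++ m))) s * (slice L l g (m ++ knot :: s) * z) := by
  unfold loop
  simp only [mul_assoc, slice_append, List.append_assoc, List.append_nil]
  have h1 := exchange L l (m ++ [knot]) s g (.cup link) (t := t) (p := p)
    (hf := Bool.and_false _)
  have h2 := exchange L l m (link :: s) g (.cross (!e) knot link) (t := t) (p := p)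
    (hf := Bool.and_false _)
  have h3 := exchange L l m (link :: s) g (.cross (!e) link knot) (t := t) (p := p)
    (hf := Bool.and_false _)
  have h4 := exchange L l (m ++ [knot]) s g (.cap link) (t := t) (p := p)
    (hf := Bool.and_false _)
  have c1 : ∀ x : List Colour, (Gen.cup link).src ++ x = x := fun x => rfl
  have c2 : ∀ x : List Colour, (Gen.cup link).tgt ++ x = link :: link :: x := fun x => rfl
  have c3 : ∀ x : List Colour, (Gen.cap link).src ++ x = link :: link :: x := fun x => rfl
  have c4 : ∀ x : List Colour, (Gen.cap link).tgt ++ x = x := fun x => rfl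
  have c5 : ∀ e a b (x : List Colour), (Gen.cross e a b).src ++ x = a :: b :: x := fun _ _ _ x => rfl
  have c6 : ∀ e a b (x : List Colour), (Gen.cross e a b).tgt ++ x = b :: a :: x := fun _ _ _ x => rfl
  simp only [c1, c2, c3, c4, c5, c6, List.append_assoc, List.cons_append, List.nil_append]
    at h1 h2 h3 h4
  rw [h1, h2, h3, h4]

theorem loop_comm_loop (e e' : Bool) (L m r : List Colour) :
    (loop e L (m ++ knot :: r) * loop e' (L ++ knot :: m) r : SliceAlg t p) =
      loop e' (L ++ knot :: m) r * loop e L (m ++ knot :: r) := by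
  refine SliceAlg.ext_mul fun z => ?_
  have hl : (loop e' (L ++ knot :: m) r : SliceAlg t p) =
      slice L (knot :: (m ++ [knot])) (.cup link) r *
        (slice L (knot :: m) (.cross (!e') knot link) (link :: r) *
        (slice L (knot :: m) (.cross (!e') link knot) (link :: r) *
        slice L (knot :: (m ++ [knot])) (.cap link) r)) := by
    unfold loop
    simp only [slice_append, List.cons_append, List.append_nil]
  have h1 := loop_comm_right (t := t) (p := p) e L (m ++ [knot]) r (.cup link)
  have h2 := loop_comm_right (t := t) (p := p) e L m (link :: r) (.cross (!e') knot link)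
  have h3 := loop_comm_right (t := t) (p := p) e L m (link :: r) (.cross (!e') link knot)
  have h4 := loop_comm_right (t := t) (p := p) e L (m ++ [knot]) r (.cap link)
  simp only [Gen.src, Gen.tgt, List.append_assoc, List.cons_append, List.nil_append]
    at h1 h2 h3 h4
  rw [hl]
  simp only [mul_assoc]
  rw [h1, h2, h3, h4]

theorem loopPair_comm_right (L m r : List Colour) (g : Gen) (z : SliceAlg t p) :
    loopPair L (m ++ (g.src ++ r)) * (slice L (knot :: knot :: m) g r * z) =
      slice L (knot :: knot :: m) g r * (loopPair L (m ++ (g.tgt ++ r)) * z) := by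
  rw [loopPair_eq_left, loopPair_eq_left]
  simp only [mul_assoc]
  erw [exchange L [] (knot :: knot :: m) r (.cap link) g,
    exchange L [link] (knot :: m) r (.cross true knot link) g,
    exchange L [link, knot] m r (.cross true knot link) g,
    exchange L [link, knot] m r (.cross true link knot) g,
    exchange L [link] (knot :: m) r (.cross true link knot) g,
    exchange L [] (knot :: knot :: m) r (.cup link) g]
  rfl

theorem loopPair_comm_loop (e' : Bool) (L m r : List Colour) :
    (loopPair L (m ++ knot :: r) * loop e' (L ++ knot :: knot :: m) r : SliceAlg t p) =
      loop e' (L ++ knot :: knot :: m) r * loopPair L (m ++ knot :: r) := by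
  refine SliceAlg.ext_mul fun z => ?_
  have hl : (loop e' (L ++ knot :: knot :: m) r : SliceAlg t p) =
      slice L (knot :: knot :: (m ++ [knot])) (.cup link) r *
        (slice L (knot :: knot :: m) (.cross (!e') knot link) (link :: r) *
        (slice L (knot :: knot :: m) (.cross (!e') link knot) (link :: r) *
        slice L (knot :: knot :: (m ++ [knot])) (.cap link) r)) := by
    unfold loop
    simp only [slice_append, List.cons_append, List.append_nil]
  have h1 := loopPair_comm_right (t := t) (p := p) L (m ++ [knot]) r (.cup link)
  have h2 := loopPair_comm_right (t := t) (p := p) L m (link :: r) (.cross (!e') knot link)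
  have h3 := loopPair_comm_right (t := t) (p := p) L m (link :: r) (.cross (!e') link knot)
  have h4 := loopPair_comm_right (t := t) (p := p) L (m ++ [knot]) r (.cap link)
  simp only [Gen.src, Gen.tgt, List.append_assoc, List.cons_append, List.nil_append]
    at h1 h2 h3 h4
  rw [hl]
  simp only [mul_assoc]
  rw [h1, h2, h3, h4]

/-- The negative crossing of the two strands of the braid. -/
noncomputable def sigma (r : List Colour) : SliceAlg t p :=
  slice [] [] (.cross false knot knot) r

/-- The link strand to the right of the two strands of the braid runs once around the first one,
passing in front of the second one for `e = true` and behind it for `e = false`. -/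
noncomputable def windFar (e : Bool) (r : List Colour) : SliceAlg t p :=
  slice [] [knot] (.cross (!e) knot link) r * (slice [] [] (.cross false knot link) (knot :: r) *
    (slice [] [] (.cross false link knot) (knot :: r) * slice [] [knot] (.cross e link knot) r))

theorem wind_mul_sigma (r : List Colour) :
    (wind true [knot] r * sigma (link :: r) : SliceAlg t p) =
      sigma (link :: r) * windFar true r := by
  refine SliceAlg.ext_mul fun z => ?_
  unfold sigma windFar wind
  simp only [mul_assoc, slice_singleton]
  erw [reidemeister3 [] [] r knot knot link false false false,
    ← reidemeister3 [] [] r link knot knot true false false,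
    reidemeister2 [] [] (knot :: r) knot link false,
    strands_mul_slice' [] [knot] (.cross false link knot) r]
  rfl

theorem windFar_mul_sigma (r : List Colour) :
    (windFar false r * sigma (link :: r) : SliceAlg t p) =
      sigma (link :: r) * wind true [knot] r := by
  refine SliceAlg.ext_mul fun z => ?_
  unfold sigma windFar wind
  simp only [mul_assoc, slice_singleton]
  erw [reidemeister3 [] [] r link knot knot false false false,
    ← reidemeister3 [] [] r knot knot link false false true,
    reidemeister2 [] [] (knot :: r) knot link true,
    strands_mul_slice' [] [knot] (.cross false link knot) r]
  rfl

theorem windPair_mul_sigma (r : List Colour) :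
    (windPair true [] r * sigma (link :: r) : SliceAlg t p) =
      sigma (link :: r) * windPair true [] r := by
  refine SliceAlg.ext_mul fun z => ?_
  unfold sigma windPair
  simp only [mul_assoc]
  erw [reidemeister3 [] [] r link knot knot false false false,
    reidemeister3 [] [] r knot knot link false false false]
  rfl

theorem windPair_mul_wind_false (r : List Colour) :
    (windPair true [] r * wind false [knot] r : SliceAlg t p) = windFar true r := by
  refine SliceAlg.ext_mul fun z => ?_
  unfold windPair wind windFar
  simp only [mul_assoc, slice_singleton]
  erw [reidemeister2 [] [knot] r link knot false,
    strands_mul_slice' [] [knot] (.cross true link knot) r]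
  rfl

theorem wind_false_mul_wind_true (L r : List Colour) :
    (wind false L r * wind true L r : SliceAlg t p) = strands (L ++ knot :: link :: r) := by
  refine SliceAlg.ext_mul fun z => ?_
  unfold wind
  simp only [mul_assoc]
  have h := strands_mul_slice' (t := t) (p := p) L [] (.cross false link knot) r z
  have h' := reidemeister2 L [] r knot link true z
  erw [reidemeister2 L [] r link knot true, h, h']
  rfl

theorem wind_true_mul_wind_false (L r : List Colour) :
    (wind true L r * wind false L r : SliceAlg t p) = strands (L ++ knot :: link :: r) := by
  refine SliceAlg.ext_mul fun z => ?_
  unfold wind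
  simp only [mul_assoc]
  have h := strands_mul_slice' (t := t) (p := p) L [] (.cross true link knot) r z
  have h' := reidemeister2 L [] r knot link false z
  erw [reidemeister2 L [] r link knot false, h, h']
  rfl

/-- The link strand winds around the pair of strands, backwards, and around the second one. What
remains is a turn around the first strand behind the second one, and is resolved. -/
theorem windPair_false_mul_wind (r : List Colour) :
    (windPair false [] r * wind true [knot] r : SliceAlg t p) =
      -(((t ^ (-2 : ℤ) : Rˣ) : R) • loop true [] (knot :: link :: r)) -
        ((t ^ (-4 : ℤ) : Rˣ) : R) • windFar false r := by
  have h1 : (windPair false [] r * wind true [knot] r : SliceAlg t p) =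
      slice [] [knot] (.cross true knot link) r * (wind false [] (knot :: r) *
        slice [] [knot] (.cross false link knot) r) := by
    refine SliceAlg.ext_mul fun z => ?_
    unfold windPair wind
    simp only [mul_assoc, slice_singleton]
    erw [reidemeister2 [] [knot] r link knot true,
      strands_mul_slice' [] [knot] (.cross false link knot) r]
    rfl
  have h2 := loop_eq_wind (t := t) (p := p) [] (knot :: r)
  have h3 : (slice [] [knot] (.cross true knot link) r * (loop true [] (link :: knot :: r) *
        slice [] [knot] (.cross false link knot) r) : SliceAlg t p) =
      loop true [] (knot :: link :: r) := by
    refine SliceAlg.ext_mul fun z => ?_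
    simp only [mul_assoc]
    erw [loop_comm_right true [] [] r (.cross false link knot),
      reidemeister2 [] [knot] r knot link true]
    exact congrArg (· * z) (strands_mul_loop true [] (knot :: link :: r))
  have h4 : (slice [] [knot] (.cross true knot link) r * (wind true [] (knot :: r) *
        slice [] [knot] (.cross false link knot) r) : SliceAlg t p) = windFar false r := by
    unfold wind windFar
    simp only [mul_assoc]
    rfl
  rw [h1, ← h3, ← h4]
  have e1 : ((t ^ (-4 : ℤ) : Rˣ) : R) = ((t ^ (-2 : ℤ) : Rˣ) : R) * ((t ^ (-2 : ℤ) : Rˣ) : R) := by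
    rw [← Units.val_mul]
    congr 1
    group
  have e2 : ((t ^ (-2 : ℤ) : Rˣ) : R) * ((t ^ 2 : Rˣ) : R) = 1 := by
    rw [← Units.val_mul]
    simp
  exact conj_eq_of_eq_neg_sub (A := SliceAlg t p) h2 e2 e1 _ _

/-- The partial closure of `windFar` is the meridian of the first strand, since it can be pulled away
from the second one. -/
theorem trace_windFar (e : Bool) (r : List Colour) :
    (slice [] [knot, knot] (.cup link) r *
      (windFar e (link :: r) * slice [] [knot, knot] (.cap link) r) : SliceAlg t p) =
      loop true [] (knot :: r) := by
  refine SliceAlg.ext_mul fun z => ?_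
  unfold windFar loop
  simp only [mul_assoc]
  have h := cap_slide (t := t) (p := p) [] [knot] r knot link (!e) z
  have h' := reidemeister2 [] [link, knot] r link knot e (t := t) (p := p)
    (slice [] [knot] (.cap link) (knot :: r) * z)
  have h'' := reidemeister2 [] [knot, link] r link knot e (t := t) (p := p)
    (slice [] [knot] (.cap link) (knot :: r) * z)
  rw [Bool.not_not] at h
  erw [cup_slide [] [knot] r knot link (!e), ← h,
    ← exchange [] [] [] r (.cross false knot link) (.cross (!!e) link knot),
    ← exchange [] [] [] r (.cross false link knot) (.cross (!!e) link knot)]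
  rw [Bool.not_not]
  erw [h'', strands_mul_slice' [] [knot] (.cap link) (knot :: r)]
  rfl

/-- Let `x = -a w - b w'`, and let `y` and `y'` be the closures of `w` and `w'`. If the closure of `x`
is `-(a + b) y`, then `y' = y`. -/
theorem eq_of_closure {A : Type*} [Ring A] [Algebra R A] {x w w' u v y y' : A} {a b b' : R}
    (h : x = -(a • w) - b • w') (hb : b' * b = 1) (hx : u * (x * v) = (-b - a) • y)
    (hw : u * (w * v) = y) (hw' : u * (w' * v) = y') : y' = y := by
  rw [h] at hx
  simp only [sub_mul, mul_sub, neg_mul, mul_neg, smul_mul_assoc, mul_smul_comm, hw, hw'] at hx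
  have h2 : b • y' = b • y := by
    rw [sub_smul, neg_smul] at hx
    have := congrArg (fun z => -(z + a • y)) hx
    rw [show -(-(a • y) - b • y' + a • y) = b • y' by abel,
      show -(-(b • y) - a • y + a • y) = b • y by abel] at this
    exact this
  have h3 := congrArg (b' • ·) h2
  simpa only [smul_smul, hb, one_smul] using h3

/-- A meridian may be turned over: the two loops are the closures of the two windings in
`loop_eq_wind`, and the closure of the left-hand side there is a meridian with a trivial circle. -/
theorem loop_false (L r : List Colour) : (loop false L r : SliceAlg t p) = loop true L r := by
  have h := loop_eq_wind (t := t) (p := p) L (link :: r)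
  have h1 : (slice L [knot] (.cup link) r * (loop true L (link :: link :: r) *
      slice L [knot] (.cap link) r) : SliceAlg t p) =
      (-((t ^ 2 : Rˣ) : R) - ((t ^ (-2 : ℤ) : Rˣ) : R)) • loop true L r := by
    have h2 := loop_comm_right (t := t) (p := p) true L [] r (.cap link) 1
    have h3 := circle (t := t) (p := p) L [knot] r (loop true L r)
    rw [mul_one, mul_one] at h2
    erw [h2, h3, strands_mul_loop]
    rfl
  have h2 : ∀ e, (slice L [knot] (.cup link) r * (wind e L (link :: r) *
      slice L [knot] (.cap link) r) : SliceAlg t p) = loop e L r := by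
    intro e
    unfold wind loop
    simp only [mul_assoc]
  exact eq_of_closure (A := SliceAlg t p) (b' := ((t ^ (-2 : ℤ) : Rˣ) : R)) h
    (by rw [← Units.val_mul]; simp) h1 (h2 true) (h2 false)

/-- A meridian passes through a crossing of the braid along its strand. -/
theorem loop_mul_sigma (r : List Colour) :
    (loop true [] (knot :: r) * sigma r : SliceAlg t p) = sigma r * loop true [knot] r := by
  rw [← trace_windFar false]
  have h := windFar_mul_sigma (t := t) (p := p) (link :: r)
  refine SliceAlg.ext_mul fun z => ?_
  have h' := congrArg (· * (slice [] [knot, knot] (.cap link) r * z)) h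
  simp only [mul_assoc, loop, wind, slice_singleton] at h' ⊢
  unfold sigma at h' ⊢
  erw [← exchange [] [] [] r (.cross false knot knot) (.cap link), h',
    ← exchange [] [] [] r (.cross false knot knot) (.cup link)]
  rfl

theorem loop_mul_sigma' (r : List Colour) :
    (loop true [knot] r * sigma r : SliceAlg t p) = sigma r * loop true [] (knot :: r) := by
  rw [← trace_windFar true]
  have h := wind_mul_sigma (t := t) (p := p) (link :: r)
  refine SliceAlg.ext_mul fun z => ?_
  have h' := congrArg (· * (slice [] [knot, knot] (.cap link) r * z)) h
  simp only [mul_assoc, loop, wind, slice_singleton] at h' ⊢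
  unfold sigma at h' ⊢
  erw [← exchange [] [] [] r (.cross false knot knot) (.cap link), h',
    ← exchange [] [] [] r (.cross false knot knot) (.cup link)]
  rfl

theorem loopPair_mul_sigma (r : List Colour) :
    (loopPair [] r * sigma r : SliceAlg t p) = sigma r * loopPair [] r := by
  have h := windPair_mul_sigma (t := t) (p := p) (link :: r)
  refine SliceAlg.ext_mul fun z => ?_
  have h' := congrArg (· * (slice [] [knot, knot] (.cap link) r * z)) h
  unfold windPair at h'
  unfold loopPair
  simp only [mul_assoc] at h' ⊢
  unfold sigma at h' ⊢
  erw [← exchange [] [] [] r (.cross false knot knot) (.cap link), h',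
    ← exchange [] [] [] r (.cross false knot knot) (.cup link)]
  rfl

end

/-! ### Curves around strands, crossings and extrema of the knot -/

section
variable {R : Type*} [CommRing R] {t : Rˣ} {p : ℕ}

theorem loop_mul_strands (e : Bool) (L r : List Colour) :
    (loop e L r : SliceAlg t p) * strands (L ++ knot :: r) = loop e L r := by
  have h := slice_mul_strands (t := t) (p := p) L [knot] (.cap link) r
  unfold loop
  simp only [mul_assoc]
  erw [h]

/-- A strand that crosses the knot passes in front of (or behind) a meridian. -/
theorem loop_mul_cross_right (e : Bool) (L r : List Colour) :
    (loop true (L ++ [link]) r * slice L [] (.cross e link knot) r : SliceAlg t p) =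
      slice L [] (.cross e link knot) r * loop true L (link :: r) := by
  refine SliceAlg.ext_mul fun z => ?_
  rw [loop_eq_left, loop_eq_left]
  simp only [mul_assoc, slice_append]
  erw [← slideCap L [] (knot :: r) link link e, exchange L [] [] r (.cap link) (.cross e link knot),
    ← exchange L [] [] r (.cross e link link) (.cross true knot link),
    ← reidemeister3 L [link] r link knot link e e true,
    ← exchange L [] [] r (.cross e link link) (.cross true link knot),
    ← reidemeister3 L [link] r link link knot e e true,
    slideCup L [] (knot :: r) link link e, exchange L [] [] r (.cup link) (.cross e link knot)]
  rfl

theorem loop_mul_cross_left (e : Bool) (L r : List Colour) :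
    (loop true L (link :: r) * slice L [] (.cross e knot link) r : SliceAlg t p) =
      slice L [] (.cross e knot link) r * loop true (L ++ [link]) r := by
  have h1 := loop_mul_cross_right (t := t) (p := p) (!e) L r
  have h2 : (slice L [] (.cross e knot link) r * slice L [] (.cross (!e) link knot) r :
      SliceAlg t p) = strands (L ++ knot :: link :: r) :=
    SliceAlg.ext_mul fun z => by rw [mul_assoc]; exact reidemeister2 L [] r knot link e z
  have h3 : (slice L [] (.cross (!e) link knot) r * slice L [] (.cross e knot link) r :
      SliceAlg t p) = strands (L ++ link :: knot :: r) :=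
    SliceAlg.ext_mul fun z => by
      have := reidemeister2 L [] r link knot (!e) z
      rw [Bool.not_not] at this
      rw [mul_assoc]
      exact this
  have h4 := loop_mul_strands (t := t) (p := p) true (L ++ [link]) r
  rw [List.append_assoc, List.singleton_append] at h4
  calc (loop true L (link :: r) * slice L [] (.cross e knot link) r : SliceAlg t p)
      = slice L [] (.cross e knot link) r * (slice L [] (.cross (!e) link knot) r *
        loop true L (link :: r)) * slice L [] (.cross e knot link) r := by
        rw [← mul_assoc, h2, strands_mul_loop]
    _ = slice L [] (.cross e knot link) r * (loop true (L ++ [link]) r *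
        (slice L [] (.cross (!e) link knot) r * slice L [] (.cross e knot link) r)) := by
        rw [← h1]
        simp only [mul_assoc]
    _ = _ := by rw [h3, h4]

theorem loop_mul_loopPair (r : List Colour) :
    (loop true [] (knot :: r) * loopPair [] r : SliceAlg t p) =
      loopPair [] r * loop true [] (knot :: r) := by
  refine SliceAlg.ext_mul fun z => ?_
  rw [loopPair_eq_left]
  have h1 := loop_mul_cross_right (t := t) (p := p) true [link] (knot :: r)
  have h2 := loop_mul_cross_left (t := t) (p := p) true [link] (knot :: r)
  rw [slice_singleton] at h1 h2
  have h1' : ∀ z : SliceAlg t p, loop true [link, link] (knot :: r) *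
      (slice [] [link] (.cross true link knot) (knot :: r) * z) =
      slice [] [link] (.cross true link knot) (knot :: r) *
        (loop true [link] (link :: knot :: r) * z) := fun z => by
    have := congrArg (· * z) h1
    simp only [mul_assoc] at this
    exact this
  have h2' : ∀ z : SliceAlg t p, loop true [link] (link :: knot :: r) *
      (slice [] [link] (.cross true knot link) (knot :: r) * z) =
      slice [] [link] (.cross true knot link) (knot :: r) *
        (loop true [link, link] (knot :: r) * z) := fun z => by
    have := congrArg (· * z) h2
    simp only [mul_assoc] at this
    exact this
  have h3 := fun g z => loop_comm_right (t := t) (p := p) true [link] [] r g z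
  simp only [slice_singleton] at h3
  simp only [mul_assoc]
  erw [← loop_comm_left true [] [] [] (knot :: r) (.cup link), h1',
    h3 (.cross true link knot), h3 (.cross true knot link), h2',
    ← loop_comm_left true [] [] [] (knot :: r) (.cap link)]
  rfl

/-- An arc that hooks the left leg of a minimum of the knot from outside slides below the minimum
and then hooks the right leg. -/
theorem hook_slide_cup (e : Bool) (L r : List Colour) (z : SliceAlg t p) :
    slice L [] (.cup knot) r * (slice L [] (.cup link) (knot :: knot :: r) *
      (slice L [link] (.cross e link knot) (knot :: r) *
      (slice L [] (.cross (!e) link knot) (link :: knot :: r) * z))) =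
    slice L [] (.cup knot) r * (slice L [knot, knot] (.cup link) r *
      (slice L [knot] (.cross e knot link) (link :: r) *
      (slice L [knot, link] (.cross (!e) knot link) r * z))) := by
  have h := cup_slide (t := t) (p := p) L [] (link :: r) link knot (!e)
  rw [Bool.not_not] at h
  erw [← exchange L [] [] r (.cup link) (.cup knot), cup_slide L [link] r link knot e,
    ← exchange L [] [] r (.cross (!e) link knot) (.cross (!e) knot link), h,
    ← exchange L [] [] r (.cup knot) (.cup link)]
  rfl

/-- The mirror image of `hook_slide_cup`, at a maximum of the knot. -/
theorem hook_slide_cap (e e' : Bool) (L r : List Colour) (z : SliceAlg t p) :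
    slice L [knot, link] (.cross e link knot) r * (slice L [knot] (.cross e' link knot) (link :: r) *
      (slice L [knot, knot] (.cap link) r * (slice L [] (.cap knot) r * z))) =
    slice L [] (.cross (!e') knot link) (link :: knot :: r) *
      (slice L [link] (.cross (!e) knot link) (knot :: r) *
      (slice L [] (.cap link) (knot :: knot :: r) * (slice L [] (.cap knot) r * z))) := by
  erw [← exchange L [] [] r (.cap knot) (.cap link), cap_slide L [] (link :: r) link knot e',
    ← exchange L [] [] r (.cross (!e') knot link) (.cross e link knot),
    cap_slide L [link] r link knot e, ← exchange L [] [] r (.cap link) (.cap knot)]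
  rfl

theorem cup_mul_loop (r : List Colour) (z : SliceAlg t p) :
    slice [] [] (.cup knot) r * (loop true [] (knot :: r) * z) =
      slice [] [] (.cup knot) r * (loop true [knot] r * z) := by
  rw [← loop_false [knot], loop_eq_left true []]
  unfold loop
  simp only [mul_assoc, slice_singleton]
  erw [cap_slide [] [] (knot :: r) knot link true, hook_slide_cup true [] r,
    cap_slide [] [knot] r knot link false]
  rfl

theorem loop_mul_cap (r : List Colour) (z : SliceAlg t p) :
    loop true [knot] r * (slice [] [] (.cap knot) r * z) =
      loop true [] (knot :: r) * (slice [] [] (.cap knot) r * z) := by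
  rw [← loop_false [knot], loop_eq_left true []]
  unfold loop
  simp only [mul_assoc, slice_singleton]
  erw [cup_slide [] [knot] r knot link true, hook_slide_cap false true [] r,
    cup_slide [] [] (knot :: r) knot link false]
  rfl

/-- An arc that hooks a strand on its right, bent by two minima on its left. -/
theorem nested_hook_right (e e' : Bool) (L r : List Colour) (z : SliceAlg t p) :
    slice L [] (.cup link) (knot :: r) * (slice L [link] (.cup link) (link :: knot :: r) *
      (slice L [link, link, link] (.cross e link knot) r *
      (slice L [link, link] (.cross e' link knot) (link :: r) *
      (slice L [link, link, knot] (.cap link) r * z)))) =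
    slice L [knot] (.cup link) r * (slice L [] (.cross (!e) knot link) (link :: r) *
      (slice L [link] (.cross (!e') knot link) r * z)) := by
  have h1 := cup_slide (t := t) (p := p) L [] r knot link (!e)
  have h2 := cup_slide (t := t) (p := p) L [link] (link :: r) knot link (!e')
  rw [Bool.not_not] at h1 h2
  have h3 := strands_mul_slice' (t := t) (p := p) L [link] (.cross (!e') knot link) r z
  erw [exchange L [link] [] r (.cup link) (.cross e link knot), ← h1, ← h2,
    exchange L [link] [] r (.cross (!e') knot link) (.cap link), zig L [link, knot] r, h3]
  rfl

/-- An arc that hooks a strand on its left, bent by two minima on its right. -/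
theorem nested_hook_left (e e' : Bool) (L r : List Colour) (z : SliceAlg t p) :
    slice L [knot] (.cup link) r * (slice L [knot, link] (.cup link) (link :: r) *
      (slice L [] (.cross e knot link) (link :: link :: link :: r) *
      (slice L [link] (.cross e' knot link) (link :: link :: r) *
      (slice L [] (.cap link) (knot :: link :: link :: r) * z)))) =
    slice L [] (.cup link) (knot :: r) * (slice L [link] (.cross (!e) link knot) r *
      (slice L [] (.cross (!e') link knot) (link :: r) * z)) := by
  have h3 := strands_mul_slice' (t := t) (p := p) L [] (.cross (!e') link knot) (link :: r) z
  erw [← exchange L [] [] (link :: r) (.cross e knot link) (.cup link),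
    cup_slide L [] r knot link e, cup_slide L [link] (link :: r) knot link e',
    ← exchange L [] [] (link :: r) (.cap link) (.cross (!e') link knot),
    zag L [] (knot :: link :: r), h3]
  rfl

end

/-! ### The braid with a link arc next to it -/

section
variable {R : Type*} [CommRing R] {t : Rˣ} {p : ℕ}

/-- A negative crossing of the braid; `n` link strands run next to it. -/
noncomputable def braid (n : ℕ) : SliceAlg t p :=
  sigma (List.replicate n link ++ [knot, knot])

/-- The meridian of the first strand of the braid (`true`) or of the second one (`false`). -/
noncomputable def mer (n : ℕ) : Bool → SliceAlg t p
  | true => loop true [] (knot :: (List.replicate n link ++ [knot, knot]))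
  | false => loop true [knot] (List.replicate n link ++ [knot, knot])

/-- The curve around both strands of the braid. -/
noncomputable def axisAt (n : ℕ) : SliceAlg t p :=
  loopPair [] (List.replicate n link ++ [knot, knot])

/-- A minimum of the link to the right of the braid. -/
noncomputable def arcCup : SliceAlg t p := slice [] [knot, knot] (.cup link) [knot, knot]

/-- A maximum of the link to the right of the braid. -/
noncomputable def arcCap : SliceAlg t p := slice [] [knot, knot] (.cap link) [knot, knot]

/-- The first link strand runs once around the second strand of the braid. -/
noncomputable def hook (e : Bool) : SliceAlg t p := wind e [knot] [link, knot, knot]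

/-- The first link strand runs once around the first strand of the braid. -/
noncomputable def farHook (e : Bool) : SliceAlg t p := windFar e [link, knot, knot]

/-- The first link strand runs once around both strands of the braid. -/
noncomputable def pairHook (e : Bool) : SliceAlg t p := windPair e [] [link, knot, knot]

theorem mer_mul_braid (n : ℕ) (i : Bool) :
    (mer n i * braid n : SliceAlg t p) = braid n * mer n (!i) := by
  cases i
  · exact loop_mul_sigma' _
  · exact loop_mul_sigma _

theorem axisAt_mul_braid (n : ℕ) :
    (axisAt n * braid n : SliceAlg t p) = braid n * axisAt n :=
  loopPair_mul_sigma _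

theorem mer_mul_arcCup (i : Bool) : (mer 0 i * arcCup : SliceAlg t p) = arcCup * mer 2 i := by
  refine SliceAlg.ext_mul fun z => ?_
  unfold arcCup
  simp only [mul_assoc]
  cases i
  · have h := loop_comm_right (t := t) (p := p) true [knot] [] [knot, knot] (.cup link) z
    rw [slice_singleton] at h
    exact h
  · exact loop_comm_right true [] [knot] [knot, knot] (.cup link) z

theorem mer_mul_arcCap (i : Bool) : (mer 2 i * arcCap : SliceAlg t p) = arcCap * mer 0 i := by
  refine SliceAlg.ext_mul fun z => ?_
  unfold arcCap
  simp only [mul_assoc]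
  cases i
  · have h := loop_comm_right (t := t) (p := p) true [knot] [] [knot, knot] (.cap link) z
    rw [slice_singleton] at h
    exact h
  · exact loop_comm_right true [] [knot] [knot, knot] (.cap link) z

theorem axisAt_mul_arcCup : (axisAt 0 * arcCup : SliceAlg t p) = arcCup * axisAt 2 := by
  refine SliceAlg.ext_mul fun z => ?_
  unfold arcCup
  simp only [mul_assoc]
  exact loopPair_comm_right [] [] [knot, knot] (.cup link) z

theorem braid_mul_arcCup : (braid 0 * arcCup : SliceAlg t p) = arcCup * braid 2 := by
  refine SliceAlg.ext_mul fun z => ?_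
  unfold arcCup braid sigma
  simp only [mul_assoc]
  exact exchange [] [] [] [knot, knot] (.cross false knot knot) (.cup link) z

theorem braid_mul_arcCap : (braid 2 * arcCap : SliceAlg t p) = arcCap * braid 0 := by
  refine SliceAlg.ext_mul fun z => ?_
  unfold arcCap braid sigma
  simp only [mul_assoc]
  exact exchange [] [] [] [knot, knot] (.cross false knot knot) (.cap link) z

theorem hook_mul_braid : (hook true * braid 2 : SliceAlg t p) = braid 2 * farHook true :=
  wind_mul_sigma _

theorem farHook_mul_braid : (farHook false * braid 2 : SliceAlg t p) = braid 2 * hook true :=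
  windFar_mul_sigma _

theorem pairHook_mul_braid : (pairHook true * braid 2 : SliceAlg t p) = braid 2 * pairHook true :=
  windPair_mul_sigma _

theorem axisAt_eq_pairHook :
    (axisAt 2 : SliceAlg t p) = -(((t ^ (-2 : ℤ) : Rˣ) : R) • pairHook true) -
        ((t ^ 2 : Rˣ) : R) • pairHook false :=
  loopPair_eq_wind _ _

theorem mer_eq_hook :
    (mer 2 false : SliceAlg t p) = -(((t ^ (-2 : ℤ) : Rˣ) : R) • hook true) -
        ((t ^ 2 : Rˣ) : R) • hook false :=
  loop_eq_wind _ _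

theorem pairHook_mul_hook_false : (pairHook true * hook false : SliceAlg t p) = farHook true :=
  windPair_mul_wind_false _

theorem pairHook_false_mul_hook :
    (pairHook false * hook true : SliceAlg t p) = -(((t ^ (-2 : ℤ) : Rˣ) : R) • mer 2 true) -
        ((t ^ (-4 : ℤ) : Rˣ) : R) • farHook false :=
  windPair_false_mul_wind _

theorem hook_mul_hook (e : Bool) :
    (hook e * hook (!e) : SliceAlg t p) = strands [knot, knot, link, link, knot, knot] := by
  cases e
  · exact wind_false_mul_wind_true _ _
  · exact wind_true_mul_wind_false _ _

theorem pairHook_mul_strands :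
    (pairHook true * strands [knot, knot, link, link, knot, knot] : SliceAlg t p) =
      pairHook true := by
  unfold pairHook windPair
  simp only [mul_assoc]
  erw [slice_mul_strands [] [knot] (.cross false link knot) [link, knot, knot]]
  rfl

theorem mer_mul_hook (i e : Bool) : (mer 2 i * hook e : SliceAlg t p) = hook e * mer 2 i := by
  cases i
  · have h1 := hook_mul_hook (t := t) (p := p) true
    have h2 := hook_mul_hook (t := t) (p := p) false
    simp only [Bool.not_true, Bool.not_false] at h1 h2
    rw [mer_eq_hook]
    cases e <;>
      simp only [sub_mul, mul_sub, neg_mul, mul_neg, smul_mul_assoc, mul_smul_comm, h1, h2]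
  · refine SliceAlg.ext_mul fun z => ?_
    have h := fun (m r : List Colour) g z => loop_comm_right (t := t) (p := p) true [] m r g z
    unfold hook wind mer
    simp only [slice_singleton, mul_assoc]
    erw [h [] [link, knot, knot] (.cross (!e) knot link),
      h [] [link, knot, knot] (.cross (!e) link knot)]
    rfl

theorem trace_farHook : (arcCup * (farHook true * arcCap) : SliceAlg t p) = mer 0 true :=
  trace_windFar true [knot, knot]

theorem trace_hook (e : Bool) : (arcCup * (hook e * arcCap) : SliceAlg t p) = mer 0 false := by
  have h : (arcCup * (hook e * arcCap) : SliceAlg t p) = loop e [knot] [knot, knot] := by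
    unfold arcCup arcCap hook wind loop
    simp only [slice_singleton, mul_assoc]
  rw [h]
  cases e
  · exact loop_false _ _
  · rfl

theorem trace_pairHook : (arcCup * (pairHook true * arcCap) : SliceAlg t p) = axisAt 0 := by
  unfold arcCup arcCap pairHook axisAt windPair loopPair
  simp only [mul_assoc]
  rfl

theorem arcCup_mul_arcCap :
    (arcCup * arcCap : SliceAlg t p) = (-((t ^ 2 : Rˣ) : R) - ((t ^ (-2 : ℤ) : Rˣ) : R)) •
      strands [knot, knot, knot, knot] := by
  refine SliceAlg.ext_mul fun z => ?_
  rw [mul_assoc, smul_mul_assoc]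
  exact circle [] [knot, knot] [knot, knot] z

theorem arcCup_mul_strands :
    (arcCup * strands [knot, knot, link, link, knot, knot] : SliceAlg t p) = arcCup :=
  slice_mul_strands [] [knot, knot] (.cup link) [knot, knot]

theorem mer_comm : (mer 0 true * mer 0 false : SliceAlg t p) = mer 0 false * mer 0 true :=
  loop_comm_loop true true [] [] [knot, knot]

/-- A curve around both strands of the braid, below a hook. It is resolved against the hooking strand,
which then also winds around both strands, in one direction or the other. -/
theorem axisAt_mul_hook :
    (axisAt 2 * hook true : SliceAlg t p) = pairHook true * mer 2 false +
      ((t ^ 2 : Rˣ) : R) • farHook true + mer 2 true +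
        ((t ^ (-2 : ℤ) : Rˣ) : R) • farHook false := by
  have e1 : ((t ^ 2 : Rˣ) : R) * ((t ^ (-2 : ℤ) : Rˣ) : R) = 1 := by
    rw [← Units.val_mul]
    simp
  have e2 : ((t ^ 2 : Rˣ) : R) * ((t ^ (-4 : ℤ) : Rˣ) : R) = ((t ^ (-2 : ℤ) : Rˣ) : R) := by
    rw [← Units.val_mul]
    congr 1
    group
  have h : (pairHook true * mer 2 false : SliceAlg t p) =
      -(((t ^ (-2 : ℤ) : Rˣ) : R) • (pairHook true * hook true)) -
        ((t ^ 2 : Rˣ) : R) • farHook true := by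
    rw [mer_eq_hook, mul_sub, mul_neg, mul_smul_comm, mul_smul_comm, pairHook_mul_hook_false]
  rw [h, axisAt_eq_pairHook, sub_mul, neg_mul, smul_mul_assoc, smul_mul_assoc,
    pairHook_false_mul_hook, smul_sub, smul_neg, smul_smul, smul_smul, e1, e2]
  module

end

/-! ### The curves through the gap of the braid -/

section
variable {R : Type*} [CommRing R] {t : Rˣ} {p : ℕ}

theorem mul_pow_of_mul {A : Type*} [Monoid A] {a b c : A} (h : a * b = c * a) (n : ℕ) :
    a * b ^ n = c ^ n * a :=
  SemiconjBy.pow_right (a := a) (x := b) (y := c) h n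

theorem mer_mul_braid_pow (n : ℕ) (i : Bool) (k : ℕ) :
    (mer n i * braid n ^ k : SliceAlg t p) = braid n ^ k * mer n ((!·)^[k] i) := by
  induction k generalizing i with
  | zero => simp
  | succ k ih =>
    rw [pow_succ', ← mul_assoc, mer_mul_braid, mul_assoc, ih, ← mul_assoc, Function.iterate_succ]
    rfl

theorem axisAt_mul_braid_pow (n k : ℕ) :
    (axisAt n * braid n ^ k : SliceAlg t p) = braid n ^ k * axisAt n :=
  mul_pow_of_mul (axisAt_mul_braid n) k

/-- The curve that passes through the gap between the two strands of the braid, runs upwards behind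
`k` crossings, and comes back through the gap; `j` crossings of the braid lie below it. It is
drawn with the help of two strands to the right of the braid. -/
noncomputable def hookArc (j k : ℕ) : SliceAlg t p :=
  braid 0 ^ j * (arcCup * (hook true * (braid 2 ^ k * (hook false * arcCap))))

/-- The crossings below the curve pass through the auxiliary minimum. -/
theorem hookArc_eq (j k : ℕ) :
    (hookArc j k : SliceAlg t p) =
      arcCup * (braid 2 ^ j * (hook true * (braid 2 ^ k * (hook false * arcCap)))) := by
  have h := mul_pow_of_mul (braid_mul_arcCup (t := t) (p := p)).symm j
  unfold hookArc
  rw [← mul_assoc, ← h, mul_assoc]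

theorem hookArc_zero (j : ℕ) :
    (hookArc j 0 : SliceAlg t p) = (-((t ^ 2 : Rˣ) : R) - ((t ^ (-2 : ℤ) : Rˣ) : R)) •
      (braid 0 ^ j * strands [knot, knot, knot, knot]) := by
  have h := hook_mul_hook (t := t) (p := p) true
  rw [Bool.not_true] at h
  unfold hookArc
  rw [pow_zero, one_mul, ← mul_assoc (hook true), h, ← mul_assoc, ← mul_assoc, mul_assoc _ arcCup,
    arcCup_mul_strands, mul_assoc, arcCup_mul_arcCap, mul_smul_comm]

theorem farHook_mul_hook : (farHook true * hook true : SliceAlg t p) = pairHook true := by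
  have h := hook_mul_hook (t := t) (p := p) false
  rw [Bool.not_false] at h
  rw [← pairHook_mul_hook_false, mul_assoc, h, pairHook_mul_strands]

theorem hook_false_eq : (hook false : SliceAlg t p) =
    -(((t ^ (-2 : ℤ) : Rˣ) : R) • mer 2 false) - ((t ^ (-4 : ℤ) : Rˣ) : R) • hook true := by
  have e1 : ((t ^ (-2 : ℤ) : Rˣ) : R) * ((t ^ (-2 : ℤ) : Rˣ) : R) = ((t ^ (-4 : ℤ) : Rˣ) : R) := by
    rw [← Units.val_mul]
    congr 1
    group
  have e2 : ((t ^ (-2 : ℤ) : Rˣ) : R) * ((t ^ 2 : Rˣ) : R) = 1 := by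
    rw [← Units.val_mul]
    simp
  rw [mer_eq_hook, smul_sub, smul_neg, smul_smul, smul_smul, e1, e2]
  module

theorem hook_true_eq : (hook true : SliceAlg t p) =
    -(((t ^ 2 : Rˣ) : R) • mer 2 false) - ((t ^ 4 : Rˣ) : R) • hook false := by
  have e1 : ((t ^ 2 : Rˣ) : R) * ((t ^ 2 : Rˣ) : R) = ((t ^ 4 : Rˣ) : R) := by
    rw [← Units.val_mul]
    congr 1
    group
  have e2 : ((t ^ 2 : Rˣ) : R) * ((t ^ (-2 : ℤ) : Rˣ) : R) = 1 := by
    rw [← Units.val_mul]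
    simp
  rw [mer_eq_hook, smul_sub, smul_neg, smul_smul, smul_smul, e1, e2]
  module

/-- Moved past the crossing, the lower hook winds around the first strand of the braid, next to the
upper hook around the second strand. Resolving the latter leaves two meridians and the curve around
both strands. -/
theorem hookArc_one (j : ℕ) :
    (hookArc j 1 : SliceAlg t p) =
      -(((t ^ (-2 : ℤ) : Rˣ) : R) • (braid 0 ^ (j + 1) * (mer 0 true * mer 0 false))) -
        ((t ^ (-4 : ℤ) : Rˣ) : R) • (braid 0 ^ (j + 1) * axisAt 0) := by
  have h1 : (hookArc j 1 : SliceAlg t p) =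
      braid 0 ^ (j + 1) * (arcCup * (farHook true * (hook false * arcCap))) := by
    unfold hookArc
    rw [pow_one, ← mul_assoc (hook true), hook_mul_braid, mul_assoc (braid 2), ← mul_assoc arcCup,
      ← braid_mul_arcCup, pow_succ]
    simp only [mul_assoc]
  have h2 : (arcCup * (farHook true * (mer 2 false * arcCap)) : SliceAlg t p) =
      mer 0 true * mer 0 false := by
    rw [mer_mul_arcCap, ← trace_farHook]
    simp only [mul_assoc]
  have h3 : (arcCup * (farHook true * (hook true * arcCap)) : SliceAlg t p) = axisAt 0 := by
    rw [← mul_assoc (farHook true), farHook_mul_hook, trace_pairHook]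
  rw [h1, hook_false_eq, sub_mul, neg_mul, smul_mul_assoc, smul_mul_assoc, ← h2, ← h3]
  simp only [mul_sub, mul_neg, mul_smul_comm]

/-- The recurrence for the curves through the gap: a curve around the whole braid is merged with them.
Of the four terms that result, two are again curves through the gap, which enclose one more
crossing at the lower end or one less, and two are pairs of meridians. -/
theorem axisAt_mul_hookArc (j k : ℕ) :
    (axisAt 0 * hookArc (j + 1) (k + 1) : SliceAlg t p) =
      ((t ^ 2 : Rˣ) : R) • hookArc j (k + 2) + ((t ^ (-2 : ℤ) : Rˣ) : R) • hookArc (j + 2) k +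
        braid 0 ^ (j + 1) * (mer 0 true * (braid 0 ^ (k + 1) * mer 0 false)) +
        braid 0 ^ (j + k + 2) * (mer 0 true * mer 0 ((!·)^[k + 1] false)) := by
  have h1 : (axisAt 0 * hookArc (j + 1) (k + 1) : SliceAlg t p) =
      arcCup * (braid 2 ^ (j + 1) * ((axisAt 2 * hook true) * (braid 2 ^ (k + 1) *
        (hook false * arcCap)))) := by
    rw [hookArc_eq, ← mul_assoc, axisAt_mul_arcCup, mul_assoc, ← mul_assoc (axisAt 2),
      axisAt_mul_braid_pow]
    simp only [mul_assoc]
  have h2 : (arcCup * (braid 2 ^ (j + 1) * (farHook true * (braid 2 ^ (k + 1) *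
        (hook false * arcCap)))) : SliceAlg t p) = hookArc j (k + 2) := by
    rw [hookArc_eq, pow_succ, mul_assoc _ (braid 2), ← mul_assoc (braid 2) (farHook true),
      ← hook_mul_braid, pow_succ' _ (k + 1)]
    simp only [mul_assoc]
  have h3 : (arcCup * (braid 2 ^ (j + 1) * (farHook false * (braid 2 ^ (k + 1) *
        (hook false * arcCap)))) : SliceAlg t p) = hookArc (j + 2) k := by
    rw [hookArc_eq, pow_succ' _ k, mul_assoc (braid 2), ← mul_assoc (farHook false),
      farHook_mul_braid, pow_succ _ (j + 1)]
    simp only [mul_assoc]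
  have h4 : (arcCup * (braid 2 ^ (j + 1) * (mer 2 true * (braid 2 ^ (k + 1) *
        (hook false * arcCap)))) : SliceAlg t p) =
      braid 0 ^ (j + 1) * (mer 0 true * (braid 0 ^ (k + 1) * mer 0 false)) := by
    have h := fun n => mul_pow_of_mul (braid_mul_arcCup (t := t) (p := p)).symm n
    rw [← mul_assoc, h, mul_assoc, ← mul_assoc arcCup, ← mer_mul_arcCup, mul_assoc,
      ← mul_assoc arcCup, h, mul_assoc, trace_hook]
  have h5 : (arcCup * (braid 2 ^ (j + 1) * (pairHook true * (mer 2 false * (braid 2 ^ (k + 1) *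
        (hook false * arcCap))))) : SliceAlg t p) =
      braid 0 ^ (j + k + 2) * (mer 0 true * mer 0 ((!·)^[k + 1] false)) := by
    have h := fun n => mul_pow_of_mul (braid_mul_arcCup (t := t) (p := p)).symm n
    have h' := mul_pow_of_mul (pairHook_mul_braid (t := t) (p := p)) (k + 1)
    rw [← mul_assoc (mer 2 false), mer_mul_braid_pow, mul_assoc, ← mul_assoc (mer 2 _),
      mer_mul_hook, mul_assoc, mer_mul_arcCap, ← mul_assoc (pairHook true), h', mul_assoc,
      ← mul_assoc (pairHook true), pairHook_mul_hook_false, ← mul_assoc (_ ^ _), ← pow_add,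
      show j + 1 + (k + 1) = j + k + 2 by ring, ← mul_assoc arcCup, h, mul_assoc, ← trace_farHook]
    simp only [mul_assoc]
  rw [h1, axisAt_mul_hook, ← h2, ← h3, ← h4, ← h5]
  simp only [add_mul, mul_add, smul_mul_assoc, mul_smul_comm, mul_assoc]
  abel

/-- Both hooks of the curve may be turned over at the same time: written out in the two smoothings,
the terms with meridians cancel. -/
theorem hookArc_swap (k : ℕ) :
    (arcCup * (hook false * (braid 2 ^ k * (hook true * arcCap))) : SliceAlg t p) =
      arcCup * (hook true * (braid 2 ^ k * (hook false * arcCap))) := by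
  have h := mul_pow_of_mul (braid_mul_arcCup (t := t) (p := p)).symm k
  have h' := mul_pow_of_mul (braid_mul_arcCap (t := t) (p := p)).symm k
  have h2 : ∀ e, (arcCup * (mer 2 false * (braid 2 ^ k * (hook e * arcCap))) : SliceAlg t p) =
      mer 0 false * (braid 0 ^ k * mer 0 false) := by
    intro e
    rw [← mul_assoc, ← mer_mul_arcCup, mul_assoc, ← mul_assoc arcCup, h, mul_assoc, trace_hook]
  have h3 : ∀ e, (arcCup * (hook e * (braid 2 ^ k * (mer 2 false * arcCap))) : SliceAlg t p) =
      mer 0 false * (braid 0 ^ k * mer 0 false) := by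
    intro e
    rw [mer_mul_arcCap, ← mul_assoc (_ ^ k), ← h', ← trace_hook e]
    simp only [mul_assoc]
  have e3 : ((t ^ 4 : Rˣ) : R) * ((t ^ (-2 : ℤ) : Rˣ) : R) = ((t ^ 2 : Rˣ) : R) := by
    rw [← Units.val_mul]
    congr 1
    group
  have e4 : ((t ^ 4 : Rˣ) : R) * ((t ^ (-4 : ℤ) : Rˣ) : R) = 1 := by
    rw [← Units.val_mul]
    simp
  have h4 : (arcCup * (hook false * (braid 2 ^ k * (hook true * arcCap))) : SliceAlg t p) =
      -(((t ^ 2 : Rˣ) : R) • (arcCup * (hook false * (braid 2 ^ k * (mer 2 false * arcCap))))) -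
      ((t ^ 4 : Rˣ) : R) • (arcCup * (hook false * (braid 2 ^ k * (hook false * arcCap)))) := by
    rw [hook_true_eq]
    simp only [sub_mul, neg_mul, smul_mul_assoc, mul_sub, mul_neg, mul_smul_comm]
  have g : ∀ z : SliceAlg t p, arcCup * (hook false * z) =
      -(((t ^ (-2 : ℤ) : Rˣ) : R) • (arcCup * (mer 2 false * z))) -
        ((t ^ (-4 : ℤ) : Rˣ) : R) • (arcCup * (hook true * z)) := fun z => by
    rw [hook_false_eq]
    simp only [sub_mul, neg_mul, smul_mul_assoc, mul_sub, mul_neg, mul_smul_comm]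
  have h5 : (arcCup * (hook false * (braid 2 ^ k * (hook false * arcCap))) : SliceAlg t p) =
      -(((t ^ (-2 : ℤ) : Rˣ) : R) • (arcCup * (mer 2 false * (braid 2 ^ k * (hook false * arcCap))))) -
      ((t ^ (-4 : ℤ) : Rˣ) : R) • (arcCup * (hook true * (braid 2 ^ k * (hook false * arcCap)))) := by
    exact g _
  rw [h4, h5, h3, h2, smul_sub, smul_neg, smul_smul, smul_smul, e3, e4]
  module

end

/-! ### Sliding a hook around the closure of the braid -/

section
variable {R : Type*} [CommRing R] {t : Rˣ} {p : ℕ}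

/-- Two nested link strands end at a maximum which hooks the first closing strand of the knot; `P`
are the strands on their left. -/
noncomputable def outHook (P : List Colour) : SliceAlg t p :=
  slice [] (P ++ [link]) (.cross false link knot) [knot] *
    (slice [] P (.cross true link knot) [link, knot] * slice [] (P ++ [knot]) (.cap link) [knot])

/-- Everything to the left of the link strands of an `outHook` can pass below it. -/
theorem outHook_comm (l m : List Colour) (g : Gen) (z : SliceAlg t p) :
    outHook (l ++ (g.src ++ m)) * (slice [] l g (m ++ [knot, knot]) * z) =
      slice [] l g (m ++ [link, link, knot, knot]) * (outHook (l ++ (g.tgt ++ m)) * z) := by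
  unfold outHook
  simp only [mul_assoc, List.append_assoc]
  have h1 := exchange [] l (m ++ [link]) [knot] g (.cross false link knot) (t := t) (p := p)
    (hf := Bool.and_false _)
  have h2 := exchange [] l m [link, knot] g (.cross true link knot) (t := t) (p := p)
    (hf := Bool.and_false _)
  have h3 := exchange [] l (m ++ [knot]) [knot] g (.cap link) (t := t) (p := p)
    (hf := Bool.and_false _)
  have c3 : ∀ x : List Colour, (Gen.cap link).src ++ x = link :: link :: x := fun x => rfl
  have c4 : ∀ x : List Colour, (Gen.cap link).tgt ++ x = x := fun x => rfl
  have c5 : ∀ e a b (x : List Colour), (Gen.cross e a b).src ++ x = a :: b :: x := fun _ _ _ x => rfl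
  have c6 : ∀ e a b (x : List Colour), (Gen.cross e a b).tgt ++ x = b :: a :: x := fun _ _ _ x => rfl
  simp only [c3, c4, c5, c6, List.append_assoc, List.cons_append, List.nil_append] at h1 h2 h3
  rw [h1, h2, h3]

/-- The outer minimum of the knot. -/
noncomputable def outerCup : SliceAlg t p := slice [] [] (.cup knot) []

/-- The inner minimum of the knot. -/
noncomputable def innerCup : SliceAlg t p := slice [] [knot] (.cup knot) [knot]

/-- The two nested maxima of the knot. -/
noncomputable def knotCaps : SliceAlg t p :=
  slice [] [knot] (.cap knot) [knot] * slice [] [] (.cap knot) []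

/-- Two nested minima of the link to the right of the braid. -/
noncomputable def nestedCups : SliceAlg t p :=
  slice [] [knot, knot] (.cup link) [knot, knot] *
    slice [] [knot, knot, link] (.cup link) [link, knot, knot]

theorem outHook_mul_braid :
    (outHook [knot, knot] * braid 0 : SliceAlg t p) = braid 2 * outHook [knot, knot] := by
  refine SliceAlg.ext_mul fun z => ?_
  rw [mul_assoc, mul_assoc]
  exact outHook_comm [] [] (.cross false knot knot) z

theorem outHook_mul_braid_two :
    (outHook [knot, knot, link, link] * braid 2 : SliceAlg t p) =
      braid 4 * outHook [knot, knot, link, link] := by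
  refine SliceAlg.ext_mul fun z => ?_
  rw [mul_assoc, mul_assoc]
  exact outHook_comm [] [link, link] (.cross false knot knot) z

theorem braid_mul_nestedCups :
    (braid 0 * nestedCups : SliceAlg t p) = nestedCups * braid 4 := by
  refine SliceAlg.ext_mul fun z => ?_
  unfold nestedCups braid sigma
  simp only [mul_assoc]
  erw [exchange [] [] [] [knot, knot] (.cross false knot knot) (.cup link),
    exchange [] [] [link] [link, knot, knot] (.cross false knot knot) (.cup link)]
  rfl

/-- A hook on the right strand of the braid slides along the inner minimum of the knot onto the
first closing strand. -/
theorem innerCup_mul_hook (z : SliceAlg t p) :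
    innerCup * (arcCup * (hook true * z)) =
      innerCup * (nestedCups * (outHook [knot, knot, link, link] * z)) := by
  unfold innerCup arcCup hook wind nestedCups outHook
  simp only [mul_assoc, slice_singleton]
  have h1 := hook_slide_cup (t := t) (p := p) true [knot] [knot]
  have h2 := nested_hook_right (t := t) (p := p) false true [knot, knot] [knot]
  have h3 := fun (l : List Colour) g r => slice_append (t := t) (p := p) [] [knot, knot] l g r
  simp only [List.nil_append, List.cons_append] at h3
  simp only [slice_singleton, h3] at h1 h2
  erw [cup_slide [] [knot] [knot, knot] knot link false, h1, ← h2]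
  rfl

/-- A hook on the first closing strand slides along the inner maximum of the knot onto the right
strand of the braid. -/
theorem outHook_mul_knotCaps :
    (outHook [knot, knot] * knotCaps : SliceAlg t p) = hook true * (arcCap * knotCaps) := by
  refine SliceAlg.ext_mul fun z => ?_
  unfold knotCaps arcCap hook wind outHook
  simp only [mul_assoc, slice_singleton]
  have h := hook_slide_cap (t := t) (p := p) false true [knot] [knot]
  simp only [slice_singleton] at h
  erw [h, cap_slide [] [knot] [knot, knot] knot link true]
  rfl

/-- With two nested minima at its ends, a maximum that hooks the right strand of the braid is the
same as a minimum with this hook. -/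
theorem nestedCups_mul_hook (z : SliceAlg t p) :
    nestedCups * (wind false [knot] [link, link, link, knot, knot] *
      (slice [] [knot, knot] (.cap link) [link, link, knot, knot] * z)) =
      arcCup * (hook false * z) := by
  unfold nestedCups arcCup hook wind
  simp only [mul_assoc, slice_singleton]
  have h := nested_hook_left (t := t) (p := p) true false [knot] [knot, knot]
  simp only [slice_singleton] at h
  erw [← cap_slide [] [knot] [link, link, knot, knot] knot link false, h,
    ← cup_slide [] [knot] [knot, knot] knot link true]
  rfl

theorem outHook_mul_hook (z : SliceAlg t p) :
    outHook [knot, knot, link, link] * (hook false * (arcCap * z)) =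
      wind false [knot] [link, link, link, knot, knot] *
        (slice [] [knot, knot] (.cap link) [link, link, knot, knot] *
          (outHook [knot, knot] * z)) := by
  unfold hook wind arcCap
  simp only [mul_assoc, slice_singleton]
  erw [outHook_comm [knot] [link] (.cross true knot link),
    outHook_comm [knot] [link] (.cross true link knot),
    outHook_comm [knot, knot] [] (.cap link)]
  rfl

/-- The curve that passes through the gap of the braid below and above `k` of the crossings slides
along the closing strand: it then passes the gap below and above the other `l` crossings. -/
theorem hook_slide (k l : ℕ) :
    (innerCup * (arcCup * (hook true * (braid 2 ^ k * (hook false * (arcCap *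
      (braid 0 ^ l * knotCaps)))))) : SliceAlg t p) =
    innerCup * (braid 0 ^ k * (arcCup * (hook false * (braid 2 ^ l * (hook true *
      (arcCap * knotCaps)))))) := by
  have h1 := mul_pow_of_mul (outHook_mul_braid_two (t := t) (p := p)) k
  have h2 := mul_pow_of_mul (outHook_mul_braid (t := t) (p := p)) l
  have h3 := mul_pow_of_mul (braid_mul_nestedCups (t := t) (p := p)).symm k
  rw [innerCup_mul_hook, ← mul_assoc (outHook _), h1, mul_assoc, outHook_mul_hook,
    ← mul_assoc nestedCups, h3, mul_assoc, nestedCups_mul_hook, ← mul_assoc (outHook _), h2,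
    mul_assoc, outHook_mul_knotCaps]

/-- The curve around the first `k` crossings is also the curve around the other crossings. -/
theorem innerCup_mul_hookArc (k l : ℕ) :
    (innerCup * (hookArc 0 k * (braid 0 ^ l * knotCaps)) : SliceAlg t p) =
      innerCup * (hookArc k l * knotCaps) := by
  have h := hook_slide (t := t) (p := p) k l
  have h' := congrArg (fun A => innerCup * (braid 0 ^ k * (A * knotCaps)))
    (hookArc_swap (t := t) (p := p) l)
  simp only [mul_assoc] at h'
  rw [h'] at h
  unfold hookArc
  simp only [pow_zero, one_mul, mul_assoc]
  exact h

end

/-! ### Closing up the braid -/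

section
variable {R : Type*} [CommRing R] {t : Rˣ} {p : ℕ}

/-- The meridian of the outer closing strand of the knot. -/
noncomputable def outerMer : SliceAlg t p := loop true [knot, knot, knot] []

theorem innerCup_mul_mer (z : SliceAlg t p) :
    innerCup * (mer 0 true * z) = loop true [] [knot] * (innerCup * z) :=
  (loop_comm_right true [] [] [knot] (.cup knot) z).symm

theorem cups_mul_mer (z : SliceAlg t p) :
    outerCup * (innerCup * (mer 0 true * z)) = outerCup * (innerCup * (outerMer * z)) := by
  have h : innerCup * (outerMer * z) = loop true [knot] [] * (innerCup * z) :=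
    loop_comm_left true [] [knot] [] [] (.cup knot) z
  rw [innerCup_mul_mer, h]
  exact cup_mul_loop [] _

theorem mer_mul_knotCaps : (mer 0 true * knotCaps : SliceAlg t p) = outerMer * knotCaps := by
  refine SliceAlg.ext_mul fun z => ?_
  have h1 : ∀ z : SliceAlg t p, mer 0 true * (slice [] [knot] (.cap knot) [knot] * z) =
      slice [] [knot] (.cap knot) [knot] * (loop true [] [knot] * z) :=
    loop_comm_right true [] [] [knot] (.cap knot)
  have h2 : ∀ z : SliceAlg t p, slice [] [knot] (.cap knot) [knot] * (loop true [knot] [] * z) =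
      outerMer * (slice [] [knot] (.cap knot) [knot] * z) :=
    loop_comm_left true [] [knot] [] [] (.cap knot)
  have h3 := loop_mul_cap (t := t) (p := p) [] z
  unfold knotCaps
  simp only [mul_assoc]
  rw [h1, ← h2, h3]

theorem outerMer_mul_braid : (outerMer * braid 0 : SliceAlg t p) = braid 0 * outerMer := by
  refine SliceAlg.ext_mul fun z => ?_
  rw [mul_assoc, mul_assoc]
  exact (loop_comm_left true [] [] [knot] [] (.cross false knot knot) z).symm

theorem outerMer_mul_mer (i : Bool) :
    (outerMer * mer 0 i : SliceAlg t p) = mer 0 i * outerMer := by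
  cases i
  · exact (loop_comm_loop true true [knot] [knot] []).symm
  · exact (loop_comm_loop true true [] [knot, knot] []).symm

theorem outerMer_mul_axisAt : (outerMer * axisAt 0 : SliceAlg t p) = axisAt 0 * outerMer :=
  (loopPair_comm_loop true [] [knot] []).symm

theorem mer_mul_axisAt : (mer 0 true * axisAt 0 : SliceAlg t p) = axisAt 0 * mer 0 true :=
  loop_mul_loopPair [knot, knot]

theorem braid_pow_mul_mer (n : ℕ) (i : Bool) (k : ℕ) :
    (braid n ^ k * mer n i : SliceAlg t p) = mer n ((!·)^[k] i) * braid n ^ k := by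
  rw [mer_mul_braid_pow, ← Function.iterate_add_apply, ← two_mul, Function.iterate_mul]
  have h : (!·)^[2] = (id : Bool → Bool) := by
    funext b
    cases b <;> rfl
  rw [h, Function.iterate_id, id]

/-- The lower end of the diagram: the minima of the knot, `m` meridians and `n` curves around both
strands of the braid. -/
noncomputable def lowerEnd (m n : ℕ) : SliceAlg t p :=
  outerCup * (innerCup * (mer 0 true ^ m * axisAt 0 ^ n))

theorem lowerEnd_mul_mer (m n : ℕ) :
    (lowerEnd m n * mer 0 true : SliceAlg t p) = lowerEnd (m + 1) n := by
  have h := mul_pow_of_mul (mer_mul_axisAt (t := t) (p := p)) n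
  unfold lowerEnd
  simp only [mul_assoc]
  rw [← h, ← mul_assoc (_ ^ m), ← pow_succ]

theorem lowerEnd_mul_axisAt (m n : ℕ) :
    (lowerEnd m n * axisAt 0 : SliceAlg t p) = lowerEnd m (n + 1) := by
  unfold lowerEnd
  simp only [mul_assoc, pow_succ]

theorem lowerEnd_mul_outerMer (m n : ℕ) :
    (lowerEnd m n * outerMer : SliceAlg t p) = lowerEnd (m + 1) n := by
  have h := mul_pow_of_mul (outerMer_mul_axisAt (t := t) (p := p)) n
  have h' := mul_pow_of_mul (outerMer_mul_mer (t := t) (p := p) true) m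
  unfold lowerEnd
  simp only [mul_assoc]
  rw [← h, ← mul_assoc (_ ^ m), ← h', mul_assoc, ← cups_mul_mer, ← mul_assoc (mer 0 true),
    ← pow_succ']

/-- The skein that is obtained from a skein in the region of the braid by closing it up. -/
noncomputable def closing (m n : ℕ) : SliceAlg t p →ₗ[R] SkeinModule t p :=
  closedSkein ∘ₗ LinearMap.mulLeft R (lowerEnd m n) ∘ₗ LinearMap.mulRight R knotCaps

theorem closing_apply (m n : ℕ) (A : SliceAlg t p) :
    closing m n A = closedSkein (lowerEnd m n * (A * knotCaps)) := rfl

theorem closing_mer_mul (m n : ℕ) (A : SliceAlg t p) :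
    closing m n (mer 0 true * A) = closing (m + 1) n A := by
  rw [closing_apply, mul_assoc, ← mul_assoc, lowerEnd_mul_mer, closing_apply]

theorem closing_axisAt_mul (m n : ℕ) (A : SliceAlg t p) :
    closing m n (axisAt 0 * A) = closing m (n + 1) A := by
  rw [closing_apply, mul_assoc, ← mul_assoc, lowerEnd_mul_axisAt, closing_apply]

theorem closing_outerMer_mul (m n : ℕ) (A : SliceAlg t p) :
    closing m n (outerMer * A) = closing (m + 1) n A := by
  rw [closing_apply, mul_assoc, ← mul_assoc, lowerEnd_mul_outerMer, closing_apply]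

theorem closing_mul_mer (m n : ℕ) (A : SliceAlg t p) :
    closing m n (A * mer 0 true) = closing m n (A * outerMer) := by
  simp only [closing_apply, mul_assoc, mer_mul_knotCaps]

/-- The link `x ^ m y ^ n`. -/
noncomputable def xySkein (t : Rˣ) (p m n : ℕ) : SkeinModule t p :=
  closing m n (braid 0 ^ (2 * p + 1))

theorem iterate_not_odd (i : Bool) : (!·)^[2 * p + 1] i = !i := by
  have h : (!·)^[2] = (id : Bool → Bool) := by
    funext b
    cases b <;> rfl
  rw [Function.iterate_succ_apply', Function.iterate_mul, h, Function.iterate_id, id]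

/-- Since the closure of the braid is a knot, all the meridians can be moved to the first strand. -/
theorem closing_mul_mer_mul_braid (m n : ℕ) (i : Bool) (A : SliceAlg t p)
    (hA : A = 1 ∨ ∃ j, A = mer 0 j) :
    closing m n (A * (mer 0 i * braid 0 ^ (2 * p + 1))) =
      closing (m + 1) n (A * braid 0 ^ (2 * p + 1)) := by
  have hc : outerMer * A = A * outerMer := by
    rcases hA with rfl | ⟨j, rfl⟩
    · rw [mul_one, one_mul]
    · exact outerMer_mul_mer j
  have hb := mul_pow_of_mul (outerMer_mul_braid (t := t) (p := p)) (2 * p + 1)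
  have hm : mer 0 true * A = A * mer 0 true := by
    rcases hA with rfl | ⟨j, rfl⟩
    · rw [mul_one, one_mul]
    · cases j
      · exact mer_comm
      · rfl
  cases i
  · rw [mer_mul_braid_pow, iterate_not_odd, Bool.not_false, ← mul_assoc, closing_mul_mer,
      mul_assoc, ← hb, ← mul_assoc, ← hc, mul_assoc, closing_outerMer_mul]
  · rw [← mul_assoc, ← hm, mul_assoc, closing_mer_mul]

/-- Two meridians anywhere in the closed braid. -/
theorem closing_two_mer (m n a b c : ℕ) (i j : Bool) (h : a + b + c = 2 * p + 1) :
    closing m n (braid 0 ^ a * (mer 0 i * (braid 0 ^ b * (mer 0 j * braid 0 ^ c))) :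
      SliceAlg t p) = xySkein t p (m + 2) n := by
  rw [← mul_assoc (braid 0 ^ b), braid_pow_mul_mer, mul_assoc, ← pow_add, ← mul_assoc (mer 0 i),
    ← mul_assoc, ← mul_assoc, braid_pow_mul_mer, mul_assoc _ _ (mer 0 _), braid_pow_mul_mer,
    mul_assoc, mul_assoc, ← pow_add, ← add_assoc, h, closing_mul_mer_mul_braid _ _ _ _ (.inr ⟨_, rfl⟩)]
  have h1 := closing_mul_mer_mul_braid (t := t) (p := p) (m + 1) n ((!·)^[a] i) 1 (.inl rfl)
  rw [one_mul, one_mul] at h1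
  rw [h1]
  rfl

theorem strands_mul_braid :
    (strands [knot, knot, knot, knot] * braid 0 : SliceAlg t p) = braid 0 :=
  strands_mul_slice [] [] (.cross false knot knot) [knot, knot]

theorem strands_mul_knotCaps :
    (strands [knot, knot, knot, knot] * knotCaps : SliceAlg t p) = knotCaps :=
  strands_mul_slice' [] [knot] (.cap knot) [knot] _

theorem closing_strands (m n j : ℕ) (l : ℕ) :
    closing m n (braid 0 ^ j * strands [knot, knot, knot, knot] * braid 0 ^ l : SliceAlg t p) =
      closing m n (braid 0 ^ (j + l)) := by
  cases l with
  | zero =>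
    simp only [closing_apply, mul_assoc, pow_zero, one_mul, add_zero, strands_mul_knotCaps]
  | succ l =>
    rw [pow_succ' _ l, mul_assoc, ← mul_assoc (strands _), strands_mul_braid, ← pow_succ',
      ← pow_add]

theorem closing_hookArc_zero (m n j l : ℕ) (h : j + l = 2 * p + 1) :
    closing m n (hookArc j 0 * braid 0 ^ l : SliceAlg t p) =
      (-((t ^ 2 : Rˣ) : R) - ((t ^ (-2 : ℤ) : Rˣ) : R)) • xySkein t p m n := by
  rw [hookArc_zero, smul_mul_assoc, map_smul, closing_strands, h]
  rfl

theorem closing_hookArc_one (m n j l : ℕ) (h : j + 1 + l = 2 * p + 1) :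
    closing m n (hookArc j 1 * braid 0 ^ l : SliceAlg t p) =
      -(((t ^ (-2 : ℤ) : Rˣ) : R) • xySkein t p (m + 2) n) -
        ((t ^ (-4 : ℤ) : Rˣ) : R) • xySkein t p m (n + 1) := by
  have h1 := closing_two_mer (t := t) m n (j + 1) 0 l true false h
  rw [pow_zero, one_mul] at h1
  rw [hookArc_one, sub_mul, neg_mul, smul_mul_assoc, smul_mul_assoc, map_sub, map_neg, map_smul,
    map_smul, mul_assoc, mul_assoc (mer 0 true), h1, ← axisAt_mul_braid_pow, mul_assoc, ← pow_add,
    h, closing_axisAt_mul]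
  rfl

theorem closing_hookArc_succ (m n j k l : ℕ) (h : j + k + 2 + l = 2 * p + 1) :
    closing m (n + 1) (hookArc (j + 1) (k + 1) * braid 0 ^ l : SliceAlg t p) =
      ((t ^ 2 : Rˣ) : R) • closing m n (hookArc j (k + 2) * braid 0 ^ l : SliceAlg t p) +
        ((t ^ (-2 : ℤ) : Rˣ) : R) • closing m n (hookArc (j + 2) k * braid 0 ^ l : SliceAlg t p) +
        (2 : R) • xySkein t p (m + 2) n := by
  have h1 := closing_two_mer (t := t) (p := p) m n (j + 1) (k + 1) l true false (by omega)
  have h2 := closing_two_mer (t := t) (p := p) m n (j + k + 2) 0 l true ((!·)^[k + 1] false) (by omega)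
  rw [pow_zero, one_mul] at h2
  rw [← closing_axisAt_mul, ← mul_assoc, axisAt_mul_hookArc]
  simp only [add_mul, smul_mul_assoc, map_add, map_smul, mul_assoc]
  rw [h1, h2, two_smul, add_assoc _ (xySkein _ _ _ _)]

theorem closing_hookArc_slide (m k l : ℕ) :
    closing m 0 (hookArc 0 k * braid 0 ^ l : SliceAlg t p) = closing m 0 (hookArc k l) := by
  have h : ∀ z : SliceAlg t p, innerCup * (mer 0 true ^ m * z) =
      loop true [] [knot] ^ m * (innerCup * z) := by
    intro z
    induction m with
    | zero => simp
    | succ m ih => rw [pow_succ', mul_assoc, innerCup_mul_mer, ih, ← mul_assoc, ← pow_succ']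
  unfold closing lowerEnd
  simp only [LinearMap.comp_apply, LinearMap.mulLeft_apply, LinearMap.mulRight_apply, mul_assoc,
    pow_zero, one_mul, h, innerCup_mul_hookArc]

theorem skein_xyDiagram (m n : ℕ) : (xyDiagram p m n).skein t = xySkein t p m n := by
  have hm : (op meridian : SliceAlg t p) = mer 0 true := by
    unfold mer
    rw [loop_eq_left]
    simp only [meridian, op_cons_slice, op_nil, mul_one]
    rfl
  have ha : (op axis : SliceAlg t p) = axisAt 0 := by
    unfold axisAt
    rw [loopPair_eq_left]
    simp only [axis, op_cons_slice, op_nil, mul_one]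
    rfl
  have hb : (op (knotTwists p) : SliceAlg t p) = braid 0 ^ (2 * p + 1) := by
    have := op_replicate (t := t) (p := p) [⟨[], .cross false knot knot, [knot, knot]⟩] (2 * p + 1)
    rw [op_cons_slice, op_nil, mul_one] at this
    simpa [knotTwists, braid, sigma] using this
  rw [← Diagram.wordSkein_word, ← closedSkein_op]
  change closedSkein (op (xyWord p m n)) = _
  unfold xyWord
  simp only [op_append, op_replicate, hm, ha, hb, knotBottom, knotTop, op_cons_slice, op_nil,
    mul_one]
  unfold xySkein
  rw [closing_apply]
  unfold lowerEnd outerCup innerCup knotCaps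
  simp only [mul_assoc]

end

/-! ### The polynomials of the curves through the gap -/

section
open Polynomial
variable {K : Type*} [CommRing K]

/-- The polynomials in `y` and `b = x²` that describe the curves `hookArc j k`; here `q = t²` and
`q' = t⁻²`. -/
noncomputable def arcPoly (q q' b : K[X]) : ℕ → K[X]
  | 0 => -q - q'
  | 1 => -(q' * b) - q' ^ 2 * X
  | k + 2 => q' * (X * arcPoly q q' b (k + 1)) - q' ^ 2 * arcPoly q q' b k - 2 * (q' * b)

theorem arcPoly_add_two (q q' b : K[X]) (k : ℕ) : arcPoly q q' b (k + 2) =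
    q' * (X * arcPoly q q' b (k + 1)) - q' ^ 2 * arcPoly q q' b k - 2 * (q' * b) := rfl

/-- The constant term of the recurrence of `arcPoly` cancels in the differences of successive
polynomials, which are therefore combinations of Chebyshev polynomials. -/
theorem arcPoly_succ_sub {q q' : K[X]} (h : q * q' = 1) (b : K[X]) (k : ℕ) :
    arcPoly q q' b (k + 1) - arcPoly q q' b k = q' ^ k *
      (-(b * (q' * Chebyshev.S K k + Chebyshev.S K (k - 1))) -
        q' ^ 2 * Chebyshev.S K (k + 1) + Chebyshev.S K (k - 1) +
        q' * Chebyshev.S K k - q * Chebyshev.S K (k - 2)) := by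
  induction k using Nat.twoStepInduction with
  | zero =>
    have e1 : Chebyshev.S K (-2) = -1 := Chebyshev.S_neg_two K
    simp only [arcPoly, Nat.cast_zero, zero_add, zero_sub, Chebyshev.S_zero, Chebyshev.S_one,
      Chebyshev.S_neg_one, e1]
    ring
  | one =>
    have e : Chebyshev.S K (1 + 1) = X ^ 2 - 1 := Chebyshev.S_two K
    have e' : Chebyshev.S K (1 - 2) = 0 := Chebyshev.S_neg_one K
    simp only [arcPoly, Nat.cast_one, sub_self, e, Chebyshev.S_zero, Chebyshev.S_one, e']
    linear_combination q' * h
  | more k ih1 ih2 =>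
    have r := fun n => Chebyshev.S_add_two K n
    have r1 := r (k - 2)
    have r2 := r (k - 1)
    have r3 := r k
    have r4 := r (k + 1)
    rw [show (k : ℤ) - 2 + 2 = k by ring, show (k : ℤ) - 2 + 1 = k - 1 by ring] at r1
    rw [show (k : ℤ) - 1 + 2 = k + 1 by ring, show (k : ℤ) - 1 + 1 = k by ring] at r2
    rw [show (k : ℤ) + 1 + 2 = k + 3 by ring, show (k : ℤ) + 1 + 1 = k + 2 by ring] at r4
    push_cast at ih2 ⊢
    rw [show (k : ℤ) + 1 - 1 = k by ring, show (k : ℤ) + 1 - 2 = k - 1 by ring,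
      show (k : ℤ) + 1 + 1 = k + 2 by ring] at ih2
    rw [show (k : ℤ) + 2 - 1 = k + 1 by ring, show (k : ℤ) + 2 - 2 = k by ring,
      show (k : ℤ) + 2 + 1 = k + 3 by ring]
    have h3 : arcPoly q q' b (k + 2 + 1) - arcPoly q q' b (k + 2) =
        q' * (X * (arcPoly q q' b (k + 1 + 1) - arcPoly q q' b (k + 1))) -
          q' ^ 2 * (arcPoly q q' b (k + 1) - arcPoly q q' b k) := by
      rw [show k + 2 + 1 = k + 1 + 2 from rfl, arcPoly_add_two q q' b (k + 1),
        arcPoly_add_two q q' b k]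
      ring
    rw [h3, ih1, ih2, r4, r3, r2, r1]
    ring

/-- The combination of Chebyshev polynomials on the left-hand side of the theorem, up to the
factor `t`; here `q = t²` and `q' = t⁻²`. -/
noncomputable def pairedS (q q' : K[X]) (p i : ℕ) : K[X] :=
  q' ^ i * Chebyshev.S K (p + i) + q ^ (i + 1) * Chebyshev.S K (p - i - 1)

/-- The difference of the two middle polynomials. As the curve around `p` of the crossings is also the
curve around the other `p + 1`, this is a relation in the skein module. -/
theorem arcPoly_sub_middle {q q' : K[X]} (h : q * q' = 1) (b : K[X]) (p : ℕ) :
    q ^ (p + 1) * (arcPoly q q' b (p + 1) - arcPoly q q' b p) =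
      pairedS q q' p 0 - pairedS q q' p 1 - b * pairedS q q' p 0 := by
  have hp : q ^ (p + 1) * q' ^ p = q := by
    rw [pow_succ', mul_assoc, ← mul_pow, h, one_pow, mul_one]
  rw [arcPoly_succ_sub h, ← mul_assoc, hp]
  unfold pairedS
  push_cast
  rw [show (p : ℤ) - 1 - 1 = p - 2 by ring, add_zero, sub_zero]
  linear_combination (-b * Chebyshev.S K p - q' * Chebyshev.S K (p + 1) + Chebyshev.S K p) * h

/-- Two differences that lie symmetrically to the middle. -/
theorem arcPoly_sub_add_sub {q q' : K[X]} (h : q * q' = 1) (b : K[X]) (j m : ℕ) :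
    q ^ (j + m + 1) * (arcPoly q q' b (j + m + j + 1) - arcPoly q q' b (j + m + j) +
        (arcPoly q q' b (m + 1) - arcPoly q q' b m)) =
      q * q' ^ j *
        (-(b * (q' * Chebyshev.S K (j + m + j) + Chebyshev.S K (j + m + j - 1))) -
        q' ^ 2 * Chebyshev.S K (j + m + j + 1) + Chebyshev.S K (j + m + j - 1) +
        q' * Chebyshev.S K (j + m + j) - q * Chebyshev.S K (j + m + j - 2)) +
      q ^ (j + 1) * (-(b * (q' * Chebyshev.S K m + Chebyshev.S K (m - 1))) -
        q' ^ 2 * Chebyshev.S K (m + 1) + Chebyshev.S K (m - 1) +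
        q' * Chebyshev.S K m - q * Chebyshev.S K (m - 2)) := by
  have hp : ∀ n, q ^ n * q' ^ n = 1 := fun n => by rw [← mul_pow, h, one_pow]
  have h1 : q ^ (j + m + 1) * q' ^ (j + m + j) = q * q' ^ j := by
    rw [pow_succ', pow_add q' (j + m), mul_assoc, ← mul_assoc (q ^ _), hp, one_mul]
  have h2 : q ^ (j + m + 1) * q' ^ m = q ^ (j + 1) := by
    rw [add_right_comm, pow_add, mul_assoc, hp, mul_one]
  rw [mul_add, arcPoly_succ_sub h, arcPoly_succ_sub h, ← mul_assoc, ← mul_assoc, h1, h2]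
  push_cast
  rfl

theorem arcPoly_sub_add_sub_one {q q' : K[X]} (h : q * q' = 1) (b : K[X]) (m : ℕ) :
    q ^ (1 + m + 1) * (arcPoly q q' b (1 + m + 1 + 1) - arcPoly q q' b (1 + m + 1) +
        (arcPoly q q' b (m + 1) - arcPoly q q' b m)) =
      pairedS q q' (1 + m) 1 - pairedS q q' (1 + m) 2 -
        b * (pairedS q q' (1 + m) 1 + pairedS q q' (1 + m) 0) := by
  rw [arcPoly_sub_add_sub h]
  unfold pairedS
  push_cast
  linear_combination (norm := ring_nf) (-b * q' * Chebyshev.S K (m + 2) - b * Chebyshev.S K (m + 1) -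
    q' ^ 2 * Chebyshev.S K (m + 3) - q * q' * Chebyshev.S K (m + 1) + q' * Chebyshev.S K (m + 2) -
    b * q * Chebyshev.S K m) * h

theorem arcPoly_sub_add_sub_add_two {q q' : K[X]} (h : q * q' = 1) (b : K[X]) (j m : ℕ) :
    q ^ (j + 2 + m + 1) * (arcPoly q q' b (j + 2 + m + (j + 2) + 1) -
        arcPoly q q' b (j + 2 + m + (j + 2)) + (arcPoly q q' b (m + 1) - arcPoly q q' b m)) =
      pairedS q q' (j + 2 + m) (j + 2) + pairedS q q' (j + 2 + m) (j + 1) -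
        pairedS q q' (j + 2 + m) (j + 3) - pairedS q q' (j + 2 + m) j -
        b * (pairedS q q' (j + 2 + m) (j + 2) + pairedS q q' (j + 2 + m) (j + 1)) := by
  rw [arcPoly_sub_add_sub h]
  unfold pairedS
  push_cast
  linear_combination (norm := ring_nf) (-b * q' ^ (j + 2) * Chebyshev.S K (2 * j + m + 4) -
    b * q' ^ (j + 1) * Chebyshev.S K (2 * j + m + 3) -
    q' ^ (j + 3) * Chebyshev.S K (2 * j + m + 5) + q' ^ (j + 1) * Chebyshev.S K (2 * j + m + 3) +
    q' ^ (j + 2) * Chebyshev.S K (2 * j + m + 4) -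
    q' ^ j * Chebyshev.S K (2 * j + m + 2) * (q * q' + 1) - b * q ^ (j + 2) * Chebyshev.S K m -
    q ^ (j + 1) * Chebyshev.S K (m + 1) * (q * q' + 1) + q ^ (j + 2) * Chebyshev.S K m) * h

end

/-! ### Relations between polynomials in the skein module -/

section
open Polynomial
variable {K : Type*} [CommRing K]

/-- If `arcPoly` is symmetric modulo `I`, then `pairedS` satisfies the recurrence of `(-1) ^ i c i`
modulo `I`. -/
theorem pairedS_sub_mem {u u' b : K} (h : u * u' = 1) {p : ℕ} {I : Submodule K K[X]}
    (hI : ∀ k l, k + l = 2 * p + 1 →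
      arcPoly (C u) (C u') (C b) k - arcPoly (C u) (C u') (C b) l ∈ I)
    {c : ℕ → K} (hc0 : c 0 = 1) (hc1 : c 1 = b - 1)
    (hc : ∀ n, c (n + 2) = (b - 2) * c (n + 1) - c n) {i : ℕ} (hi : i ≤ p + 1) :
    pairedS (C u) (C u') p i - C ((-1) ^ i * c i) * pairedS (C u) (C u') p 0 ∈ I := by
  have hu : (C u * C u' : K[X]) = 1 := by rw [← C_mul, h, C_1]
  have hC : ∀ (a : K) {z : K[X]}, z ∈ I → C a * z ∈ I := fun a z hz => by
    rw [← smul_eq_C_mul]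
    exact I.smul_mem a hz
  have hpair : ∀ k k' l l' n, k + l = 2 * p + 1 → k' + l' = 2 * p + 1 →
      C u ^ n * (arcPoly (C u) (C u') (C b) k - arcPoly (C u) (C u') (C b) k' +
        (arcPoly (C u) (C u') (C b) l' - arcPoly (C u) (C u') (C b) l)) ∈ I := by
    intro k k' l l' n h1 h2
    rw [← C_pow]
    refine hC _ ?_
    convert I.sub_mem (hI k l h1) (hI k' l' h2) using 1
    ring
  have h0 : pairedS (C u) (C u') p 0 - pairedS (C u) (C u') p 1 -
      C b * pairedS (C u) (C u') p 0 ∈ I := by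
    rw [← arcPoly_sub_middle hu, ← C_pow]
    exact hC _ (hI _ _ (by ring))
  -- The recurrence comes from the sum of two differences that lie symmetrically to the middle.
  have hrec : ∀ j, j + 1 ≤ p → pairedS (C u) (C u') p (j + 2) -
      C (2 - b) * pairedS (C u) (C u') p (j + 1) + pairedS (C u) (C u') p j ∈ I := by
    intro j
    induction j with
    | zero =>
      intro hj
      -- By symmetry, the term with index `-1` is the term with index `0`.
      obtain ⟨m, rfl⟩ := Nat.exists_eq_add_of_le hj
      have h1 := arcPoly_sub_add_sub_one hu (C b) m
      have h2 := hpair (1 + m + 1 + 1) (1 + m + 1) m (m + 1) (1 + m + 1) (by ring) (by ring)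
      rw [h1] at h2
      convert I.sub_mem h0 h2 using 1
      simp only [C_sub, C_ofNat]
      ring
    | succ j ih =>
      intro hj
      have ih := ih (by omega)
      obtain ⟨m, rfl⟩ := Nat.exists_eq_add_of_le hj
      have h1 := arcPoly_sub_add_sub_add_two hu (C b) j m
      have h2 := hpair (j + 2 + m + (j + 2) + 1) (j + 2 + m + (j + 2)) m (m + 1) (j + 2 + m + 1)
        (by ring) (by ring)
      rw [h1] at h2
      convert I.neg_mem (I.add_mem ih h2) using 1
      simp only [C_sub, C_ofNat]
      ring
  induction i using Nat.twoStepInduction with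
  | zero => simp [hc0]
  | one =>
    convert I.neg_mem h0 using 1
    simp only [hc1, C_mul, C_sub, C_1, pow_one, C_neg]
    ring
  | more i ih1 ih2 =>
    have h1 := hrec i (by omega)
    have h2 := I.sub_mem (I.add_mem h1 (hC (2 - b) (ih2 (by omega)))) (ih1 (by omega))
    convert h2 using 1
    simp only [hc, C_mul, C_sub, C_1, C_neg, C_pow, C_ofNat]
    ring

variable {R : Type*} [CommRing R] {t : Rˣ} {p : ℕ}

/-- The skein of a polynomial in `x` and `y`. The inner variable of `R[X][X]` is `x`, the outer one
is `y`. -/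
noncomputable def polyClass (t : Rˣ) (p : ℕ) : R[X][X] →ₗ[R] SkeinModule t p :=
  Polynomial.lsum fun n => Polynomial.lsum fun m => LinearMap.toSpanSingleton R _ (xySkein t p m n)

theorem polyClass_monomial (m n : ℕ) (a : R) :
    polyClass t p (monomial n (monomial m a)) = a • xySkein t p m n := by
  simp [polyClass, Polynomial.lsum_apply]

theorem polySkein_eq (f g : R[X]) :
    polySkein t p f g = polyClass t p (C f * g.map C) := by
  unfold polySkein
  induction f using Polynomial.induction_on' with
  | add f f' h h' =>
    rw [Polynomial.sum_add_index, h, h', C_add, add_mul, map_add]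
    · intro k
      simp [Polynomial.sum_def]
    · intro k a a'
      simp only [add_mul, add_smul]
      exact Polynomial.sum_add _ _ _
  | monomial k a =>
    rw [Polynomial.sum_monomial_index _ _ (by simp [Polynomial.sum_def])]
    induction g using Polynomial.induction_on' with
    | add g g' h h' =>
      rw [Polynomial.sum_add_index, h, h', Polynomial.map_add, mul_add, map_add]
      · simp
      · intro n b b'
        rw [mul_add, add_smul]
    | monomial n b =>
      rw [Polynomial.sum_monomial_index _ _ (by simp), map_monomial, C_mul_monomial,
        monomial_mul_C, polyClass_monomial, skein_xyDiagram]

theorem polyClass_C_C_mul (a : R) (z : R[X][X]) :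
    polyClass t p (C (C a) * z) = a • polyClass t p z := by
  rw [← map_smul]
  congr 1
  exact (Algebra.smul_def a z).symm

/-- In the closure, the curve `hookArc j k` is a polynomial in `x` and `y` that only depends on the
number `k` of crossings that it encloses. -/
theorem closing_hookArc (m n j k l : ℕ) (h : j + k + l = 2 * p + 1) :
    closing m n (hookArc j k * braid 0 ^ l : SliceAlg t p) =
      polyClass t p (monomial n (monomial m 1) *
        arcPoly (C (C ((t ^ 2 : Rˣ) : R))) (C (C ((t ^ (-2 : ℤ) : Rˣ) : R))) (C (X ^ 2)) k) := by
  have e4 : ((t ^ (-4 : ℤ) : Rˣ) : R) = ((t ^ (-2 : ℤ) : Rˣ) : R) * ((t ^ (-2 : ℤ) : Rˣ) : R) := by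
    rw [← Units.val_mul, ← zpow_add]
    rfl
  have e2 : ((t ^ (-2 : ℤ) : Rˣ) : R) * ((t ^ 2 : Rˣ) : R) = 1 := by
    rw [← Units.val_mul]
    simp
  have hx : ∀ m n, xySkein t p m n = polyClass t p (monomial n (monomial m 1)) := fun m n => by
    rw [polyClass_monomial, one_smul]
  have hy : ∀ m n, (monomial n (monomial m (1 : R)) : R[X][X]) * X =
      monomial (n + 1) (monomial m 1) := fun m n => monomial_mul_X _ _
  have hx2 : ∀ m n, (monomial n (monomial m (1 : R)) : R[X][X]) * C (X ^ 2) =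
      monomial n (monomial (m + 2) 1) := fun m n => by
    rw [monomial_mul_C, monomial_mul_X_pow]
  induction k using Nat.strong_induction_on generalizing m n j with
  | _ k ih =>
    match k with
    | 0 =>
      rw [closing_hookArc_zero m n j l (by omega), hx, arcPoly, sub_smul, neg_smul,
        ← polyClass_C_C_mul, ← polyClass_C_C_mul, ← map_neg, ← map_sub]
      congr 1
      ring
    | 1 =>
      rw [closing_hookArc_one m n j l (by omega), hx, hx, ← hx2, ← hy, arcPoly, e4, mul_smul,
        ← polyClass_C_C_mul, ← polyClass_C_C_mul, ← polyClass_C_C_mul, ← map_neg, ← map_sub]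
      congr 1
      ring
    | k + 2 =>
      have h1 := closing_hookArc_succ (t := t) (p := p) m n j k l (by omega)
      rw [ih (k + 1) (by omega) m (n + 1) (j + 1) (by omega), ih k (by omega) m n (j + 2) (by omega),
        hx, ← hx2, ← hy] at h1
      have h2 := congrArg (((t ^ (-2 : ℤ) : Rˣ) : R) • ·) h1
      simp only [smul_add, smul_smul, e2, one_smul] at h2
      rw [add_assoc, ← sub_eq_iff_eq_add] at h2
      rw [← h2, arcPoly_add_two]
      simp only [mul_smul, ← polyClass_C_C_mul, ← map_add, ← map_sub]
      congr 1
      simp only [C_ofNat]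
      ring

/-- The polynomials all of whose multiples by polynomials in `x` represent zero. -/
noncomputable def skeinRelations (t : Rˣ) (p : ℕ) : Submodule R[X] R[X][X] where
  carrier := {z | ∀ c : R[X], polyClass t p (C c * z) = 0}
  zero_mem' c := by rw [mul_zero, map_zero]
  add_mem' hz hw c := by rw [mul_add, map_add, hz, hw, add_zero]
  smul_mem' a z hz c := by
    rw [smul_eq_C_mul, ← mul_assoc, ← C_mul]
    exact hz _

/-- The two arcs of the curve through the gap enclose complementary numbers of crossings. -/
theorem arcPoly_sub_mem_skeinRelations (k l : ℕ) (h : k + l = 2 * p + 1) :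
    arcPoly (C (C ((t ^ 2 : Rˣ) : R))) (C (C ((t ^ (-2 : ℤ) : Rˣ) : R))) (C (X ^ 2)) k -
      arcPoly (C (C ((t ^ 2 : Rˣ) : R))) (C (C ((t ^ (-2 : ℤ) : Rˣ) : R))) (C (X ^ 2)) l ∈
        skeinRelations t p := by
  intro c
  induction c using Polynomial.induction_on' with
  | add c c' hc hc' => rw [C_add, add_mul, map_add, hc, hc', add_zero]
  | monomial m a =>
    have h1 := closing_hookArc (t := t) (p := p) m 0 0 k l (by omega)
    have h2 := closing_hookArc (t := t) (p := p) m 0 k l 0 (by omega)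
    rw [closing_hookArc_slide] at h1
    rw [pow_zero, mul_one, h1] at h2
    rw [monomial_zero_left] at h2
    rw [show monomial m a = C a * monomial m 1 by rw [C_mul_monomial, mul_one], C_mul, mul_assoc,
      polyClass_C_C_mul, mul_sub, map_sub, h2, sub_self, smul_zero]

/-- The left-hand side of the theorem is determined by its value for `i = 0`. -/
theorem polyClass_pairedS {i : ℕ} (hi : i ≤ p + 1) (a : R[X]) :
    polyClass t p (C a * pairedS (C (C ((t ^ 2 : Rˣ) : R))) (C (C ((t ^ (-2 : ℤ) : Rˣ) : R))) p i) =
      polyClass t p (C a * (C ((-1) ^ i * Chebyshev.S R (2 * i)) *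
        pairedS (C (C ((t ^ 2 : Rˣ) : R))) (C (C ((t ^ (-2 : ℤ) : Rˣ) : R))) p 0)) := by
  have hu : (C ((t ^ 2 : Rˣ) : R) * C ((t ^ (-2 : ℤ) : Rˣ) : R) : R[X]) = 1 := by
    rw [← C_mul, ← Units.val_mul]
    simp
  have hc : ∀ n : ℕ, Chebyshev.S R (2 * ((n + 2 : ℕ) : ℤ)) =
      (X ^ 2 - 2) * Chebyshev.S R (2 * ((n + 1 : ℕ) : ℤ)) - Chebyshev.S R (2 * (n : ℤ)) := by
    intro n
    have h1 := Chebyshev.S_add_two R (2 * (n : ℤ))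
    have h2 := Chebyshev.S_add_two R (2 * (n : ℤ) + 1)
    have h3 := Chebyshev.S_add_two R (2 * (n : ℤ) + 2)
    push_cast
    ring_nf at h1 h2 h3 ⊢
    linear_combination h3 + X * h2 + h1
  have h := pairedS_sub_mem (p := p) hu
    (fun k l => arcPoly_sub_mem_skeinRelations (t := t) k l)
    (c := fun n => Chebyshev.S R (2 * (n : ℤ))) (by simp)
    ((congrArg _ (by norm_num)).trans (Chebyshev.S_two R)) hc hi a
  rwa [mul_sub, map_sub, sub_eq_zero] at h

end

end TorusSkein

theorem theorem3p1 {R : Type*} [CommRing R] (t : Rˣ) (p : ℕ) (hp : 0 < p) (i : ℕ)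
    (hi : i ≤ p + 1) :
    ((t ^ (-2 * (i : ℤ) - 1) : Rˣ) : R) •
          TorusSkein.polySkein t p 1 (Polynomial.Chebyshev.S R ((p : ℤ) + i)) +
        ((t ^ (2 * (i : ℤ) + 1) : Rˣ) : R) •
          TorusSkein.polySkein t p 1 (Polynomial.Chebyshev.S R ((p : ℤ) - i - 1)) =
      (-1 : R) ^ i •
        TorusSkein.polySkein t p (Polynomial.Chebyshev.S R (2 * (i : ℤ)))
          (Polynomial.C (t : R) * Polynomial.Chebyshev.S R ((p : ℤ) - 1) +
            Polynomial.C ((t⁻¹ : Rˣ) : R) * Polynomial.Chebyshev.S R (p : ℤ)) := by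
  have h := TorusSkein.polyClass_pairedS (t := t) hi (Polynomial.C ((t⁻¹ : Rˣ) : R))
  have e1 : ((t ^ (-2 * (i : ℤ) - 1) : Rˣ) : R) =
      ((t⁻¹ : Rˣ) : R) * ((t ^ (-2 : ℤ) : Rˣ) : R) ^ i := by
    rw [← Units.val_pow_eq_pow_val, ← Units.val_mul, ← zpow_natCast, ← zpow_mul, ← zpow_neg_one,
      ← zpow_add, add_comm, ← sub_eq_add_neg]
  have e2 : ((t ^ (2 * (i : ℤ) + 1) : Rˣ) : R) =
      ((t⁻¹ : Rˣ) : R) * ((t ^ 2 : Rˣ) : R) ^ (i + 1) := by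
    rw [← Units.val_pow_eq_pow_val, ← Units.val_mul, ← pow_mul, ← zpow_natCast, ← zpow_neg_one,
      ← zpow_add]
    congr 2
    push_cast
    ring
  have e3 : (t : R) = ((t⁻¹ : Rˣ) : R) * ((t ^ 2 : Rˣ) : R) := by
    rw [← Units.val_mul, pow_two, inv_mul_cancel_left]
  simp only [TorusSkein.polySkein_eq, ← TorusSkein.polyClass_C_C_mul, e1, e2, Polynomial.map_add,
    Polynomial.map_mul, Polynomial.Chebyshev.map_S, Polynomial.map_C, ← map_add]
  refine Eq.trans ?_ (h.trans ?_)
  · refine congrArg _ ?_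
    unfold TorusSkein.pairedS
    simp only [Polynomial.C_mul, Polynomial.C_pow, Polynomial.C_1]
    ring
  · refine congrArg _ ?_
    unfold TorusSkein.pairedS
    rw [e3]
    simp only [Polynomial.C_mul, Polynomial.C_pow, Polynomial.C_neg, Polynomial.C_1, Nat.cast_zero,
      add_zero, sub_zero]
    ring
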